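/- **Setting.** Let $N\ge 1$, $n_1,\dots,n_N,d,m\in\mathbb N$ and $n=\sum_i n_i$. Agent $i$ chooses $x_i\in\mathbb R^{n_i}$ (no local constraints) and has a cost $J_i:\mathbb R^{n_i}\times\mathbb R^d\to\mathbb R$, an aggregation rule $\phi_i:\mathbb R^{n_i}\to\mathbb R^d$, a matrix $A_i\in\mathbb R^{m\times n_i}$ and a vector $b_i\in\mathbb R^m$. Put $x=\mathrm{col}(x_1,\dots,x_N)$, $\sigma(x)=\frac1N\sum_i\phi_i(x_i)$, $\sigma_{-i}(x_{-i})=\frac1N\sum_{j\ne i}\phi_j(x_j)$, $A=[A_1\cdots A_N]$, $b=\sum_i b_i$, and let $\mathcal C=\{x\in\mathbb R^n: Ax\le b\}$. The game is: each agent $i$ minimizes $J_i(x_i,\sigma(x))$ over $x_i$ subject to $Ax\le b$. A point $x\in\mathcal C$ is a generalized Nash equilibrium (GNE) if, for every $i$ and every $u\in\mathbb R^{n_i}$ such that replacing $x_i$ by $u$ keeps $x$ in $\mathcal C$, $J_i(x_i,\sigma(x))\le J_i(u,\frac1N\phi_i(u)+\sigma_{-i}(x_{-i}))$. With the pseudo-gradient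 $F(x)=\mathrm{col}(\nabla_{x_i}J_i(x_i,\sigma(x)))_{i=1}^N$ (the total gradient in $x_i$), a variational GNE is a point $x^\star\in\mathcal C$ with $F(x^\star)^\top(x-x^\star)\ge 0$ for all $x\in\mathcal C$. **Assumptions.** (i) $J_i$ is differentiable in each of its two arguments (gradients $\nabla_1J_i,\nabla_2J_i$), $\phi_i$ is differentiable, and $u\mapsto J_i(u,\frac1N\phi_i(u)+\sigma_{-i}(x_{-i}))$ is $C^1$ for every $x_{-i}$. (ii) $F$ is $\mu$-strongly monotone on $\mathbb R^n$ for some $\mu>0$. (iii) There are constants $\beta_1,\beta_2,\beta_3$ such that, for every $i$, the maps $(u,s)\mapsto\nabla_u[J_i(u,\frac1N\phi_i(u)+s)]$ and $\nabla_1J_i$ are $\beta_1$-Lipschitz on $\mathbb R^{n_i}\times\mathbb R^d$, $\nabla_2J_i$ is $\beta_2$-Lipschitz and $\phi_i$ is $\beta_3$-Lipschitz. (iv) The agents communicate over a strongly connected directed graph in which every agent is an in-neighbour of itself, with a doubly stochastic matrix $\mathcal W=(w_{ij})$ such that $w_{ij}>0$ if $(j,i)$ is an edge and $w_{ij}=0$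 otherwise. (v) $\mathcal C\ne\emptyset$. (vi) There are $\kappa_1,\kappa_2>0$ with $\kappa_1 I_m\preccurlyeq AA^\top\preccurlyeq\kappa_2 I_m$. **Algorithm.** Fix $\rho>0$ and a step size $\delta>0$. Write $\tilde F_i(u,s)=\nabla_1J_i(u,s)+\frac{\nabla\phi_i(u)}{N}\nabla_2J_i(u,s)$, with $\nabla\phi_i$ the transposed Jacobian; $c_i(u)=A_iu-b_i$; $G_{x,i}(s_1,s_2)=A_i^\top\max\{\rho s_1+s_2,0\}$ and $G_\lambda(s_1,s_2)=\frac1\rho(\max\{\rho s_1+s_2,0\}-s_2)$, with $\max$ taken componentwise. For $t\ge0$ and all $i$, $$\begin{aligned} x_i^{t+1}&=x_i^t-\delta\tilde F_i(x_i^t,\phi_i(x_i^t)+z_i^t)-\delta G_{x,i}(Nc_i(x_i^t)+y_i^t,\lambda_i^t),\\ \lambda_i^{t+1}&=\sum_j w_{ij}\lambda_j^t+\delta G_\lambda(Nc_i(x_i^t)+y_i^t,\lambda_i^t),\\ z_i^{t+1}&=\sum_j w_{ij}z_j^t+\sum_j w_{ij}\phi_j(x_j^t)-\phi_i(x_i^t),\\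 y_i^{t+1}&=\sum_j w_{ij}y_j^t+\sum_j w_{ij}Nc_j(x_j^t)-Nc_i(x_i^t). \end{aligned}$$ **Theorem.** Under (i)–(vi) the game has exactly one variational GNE $x^\star$, and $x^\star$ is a GNE. Moreover, there are $\bar\delta>0$ and $a_2>0$ such that for every initial condition with $x^0\in\mathbb R^n$, $\lambda_i^0\ge0$ componentwise for all $i$, $\sum_i z_i^0=0$ and $\sum_i y_i^0=0$, there is $a_1>0$ such that, for every $\delta\in(0,\bar\delta)$ with $w_{ii}>\delta/\rho$ for all $i$, $$\|x^t-x^\star\|\le a_1e^{-a_2\delta t}\qquad\text{for all }t\ge 0 .$$ In particular, for each such $\delta$ the iterates converge linearly to $x^\star$. -/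

import Mathlib

open scoped Gradient Matrix

noncomputable section

namespace AggregativeGame

/-- Euclidean space `ℝᵏ`. -/
abbrev Vec (k : ℕ) : Type := EuclideanSpace ℝ (Fin k)

/-- Collective strategies `x = col(x₁, …, x_N)` with `x_i ∈ ℝ^{n_i}`, carrying the Euclidean norm and
inner product of `ℝⁿ`, `n = n₁ + ⋯ + n_N`. -/
abbrev Profile {N : ℕ} (n : Fin N → ℕ) : Type := PiLp 2 (fun i => Vec (n i))

/-- Data of a generalized aggregative game with affine coupling constraints and no local constraints:
costs `J_i : ℝ^{n_i} × ℝ^d → ℝ`, aggregation rules `φ_i : ℝ^{n_i} → ℝ^d`, blocks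
`A_i ∈ ℝ^{m × n_i}` and local right-hand sides `b_i ∈ ℝ^m`. -/
structure Game (N d m : ℕ) (n : Fin N → ℕ) where
  J : (i : Fin N) → Vec (n i) → Vec d → ℝ
  φ : (i : Fin N) → Vec (n i) → Vec d
  A : (i : Fin N) → Matrix (Fin m) (Fin (n i)) ℝ
  b : Fin N → Vec m

namespace Game

variable {N d m : ℕ} {n : Fin N → ℕ} (G : Game N d m n)

/-- The contribution of the other agents to the aggregate,
`σ_{-i}(x_{-i}) = (1/N) ∑_{j ≠ i} φ_j(x_j)`. -/
def sigmaOthers (i : Fin N) (x : Profile n) : Vec d :=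
  (1 / (N : ℝ)) • ∑ j ∈ Finset.univ.erase i, G.φ j (x j)

/-- Agent `i`'s cost as a function of its own strategy `u`, with `s` the contribution of the others
to the aggregate: `J_i(u, φ_i(u)/N + s)`. -/
def ownCost (i : Fin N) (s : Vec d) (u : Vec (n i)) : ℝ :=
  G.J i u ((1 / (N : ℝ)) • G.φ i u + s)

/-- The total own gradient `∇_{x_i} J_i(x_i, φ_i(x_i)/N + s)`. -/
def ownGrad (i : Fin N) (u : Vec (n i)) (s : Vec d) : Vec (n i) :=
  ∇ (G.ownCost i s) u

/-- Gradient `∇₁ J_i` with respect to the first argument. -/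
def grad₁ (i : Fin N) (u : Vec (n i)) (s : Vec d) : Vec (n i) :=
  ∇ (fun u' => G.J i u' s) u

/-- Gradient `∇₂ J_i` with respect to the second argument. -/
def grad₂ (i : Fin N) (u : Vec (n i)) (s : Vec d) : Vec d :=
  ∇ (fun s' => G.J i u s') s

/-- The pseudo-gradient `F(x) = col(∇_{x_1} J_1(x_1, σ(x)), …, ∇_{x_N} J_N(x_N, σ(x)))`, using
`σ(x) = φ_i(x_i)/N + σ_{-i}(x_{-i})`. -/
def F (x : Profile n) : Profile n :=
  WithLp.toLp 2 (fun i => G.ownGrad i (x i) (G.sigmaOthers i x))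

/-- The local constraint function `c_i(u) = A_i u - b_i`. -/
def c (i : Fin N) (u : Vec (n i)) : Vec m :=
  WithLp.toLp 2 ((G.A i) *ᵥ (fun k => u k)) - G.b i

/-- The constraint matrix `A = [A_1 ⋯ A_N]`. -/
def matA : Matrix (Fin m) ((i : Fin N) × Fin (n i)) ℝ :=
  Matrix.of fun l p => G.A p.1 l p.2

/-- The feasible set `{x | A x ≤ b}`, with `A x - b = ∑_i (A_i x_i - b_i)`. -/
def feasibleSet : Set (Profile n) :=
  {x | ∀ l, (∑ i, G.c i (x i)) l ≤ 0}

/-- The strategies of agent `i` feasible given the others: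
`{u | A_i u ≤ b_i - ∑_{j ≠ i} (A_j x_j - b_j)}`. -/
def feasibleOwn (i : Fin N) (x : Profile n) : Set (Vec (n i)) :=
  {u | ∀ l, (G.c i u + ∑ j ∈ Finset.univ.erase i, G.c j (x j)) l ≤ 0}

/-- Generalized Nash equilibrium. -/
def IsGNE (x : Profile n) : Prop :=
  x ∈ G.feasibleSet ∧
    ∀ i, ∀ u ∈ G.feasibleOwn i x,
      G.ownCost i (G.sigmaOthers i x) (x i) ≤ G.ownCost i (G.sigmaOthers i x) u

/-- Variational generalized Nash equilibrium: a feasible solution of the variational inequality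
`⟪F(x⋆), x - x⋆⟫ ≥ 0` for all feasible `x`. -/
def IsVariationalGNE (xs : Profile n) : Prop :=
  xs ∈ G.feasibleSet ∧ ∀ x ∈ G.feasibleSet, 0 ≤ inner ℝ (G.F xs) (x - xs)

/-- Differentiability of the data: the gradients `∇₁ J_i`, `∇₂ J_i`, `∇ φ_i` exist, and the own costs
`u ↦ J_i(u, φ_i(u)/N + σ_{-i}(x_{-i}))` are of class `C¹`. -/
structure SmoothCosts : Prop where
  diff_fst : ∀ i s, Differentiable ℝ (fun u => G.J i u s)
  diff_snd : ∀ i u, Differentiable ℝ (fun s => G.J i u s)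
  diff_φ : ∀ i, Differentiable ℝ (G.φ i)
  contDiff_ownCost : ∀ i x, ContDiff ℝ 1 (G.ownCost i (G.sigmaOthers i x))

/-- Strong monotonicity of the pseudo-gradient. -/
def StronglyMonotone (μ : ℝ) : Prop :=
  ∀ x y : Profile n, μ * ‖x - y‖ ^ 2 ≤ inner ℝ (G.F x - G.F y) (x - y)

/-- Lipschitz continuity of the gradients and of the aggregation rules. -/
structure LipschitzCosts (β₁ β₂ β₃ : ℝ) : Prop where
  ownGrad_le : ∀ i u u' s s',
    ‖G.ownGrad i u s - G.ownGrad i u' s'‖ ≤ β₁ * √(‖u - u'‖ ^ 2 + ‖s - s'‖ ^ 2)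
  grad₁_le : ∀ i u u' s s',
    ‖G.grad₁ i u s - G.grad₁ i u' s'‖ ≤ β₁ * √(‖u - u'‖ ^ 2 + ‖s - s'‖ ^ 2)
  grad₂_le : ∀ i u u' s s',
    ‖G.grad₂ i u s - G.grad₂ i u' s'‖ ≤ β₂ * √(‖u - u'‖ ^ 2 + ‖s - s'‖ ^ 2)
  φ_le : ∀ i u u', ‖G.φ i u - G.φ i u'‖ ≤ β₃ * ‖u - u'‖

/-- The operator `F̃_i(u, s) = ∇₁ J_i(u, s) + (∇φ_i(u)/N) ∇₂ J_i(u, s)`, where `∇φ_i(u)` is the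
transposed Jacobian of `φ_i`. -/
def Ftilde (i : Fin N) (u : Vec (n i)) (s : Vec d) : Vec (n i) :=
  G.grad₁ i u s +
    (1 / (N : ℝ)) • ContinuousLinearMap.adjoint (fderiv ℝ (G.φ i) u) (G.grad₂ i u s)

/-- `G_{x,i}(s₁, s₂) = ∑_ℓ max{ρ [s₁]_ℓ + [s₂]_ℓ, 0} [A_i]_ℓᵀ`. -/
def Gx (ρ : ℝ) (i : Fin N) (s₁ s₂ : Vec m) : Vec (n i) :=
  ∑ l, max (ρ * s₁ l + s₂ l) 0 • (WithLp.toLp 2 (G.A i l) : Vec (n i))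

end Game

/-- `G_λ(s₁, s₂) = (1/ρ) ∑_ℓ (max{ρ [s₁]_ℓ + [s₂]_ℓ, 0} - [s₂]_ℓ) e_ℓ`. -/
def Glam {m : ℕ} (ρ : ℝ) (s₁ s₂ : Vec m) : Vec m :=
  WithLp.toLp 2 (fun l => (1 / ρ) * (max (ρ * s₁ l + s₂ l) 0 - s₂ l))

/-- State of the distributed algorithm: strategies, local multipliers, trackers of the aggregate and
trackers of the constraint violation. -/
structure State (N d m : ℕ) (n : Fin N → ℕ) where
  x : Profile n
  lam : Fin N → Vec m
  z : Fin N → Vec d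
  y : Fin N → Vec m

/-- One iteration of the distributed augmented primal–dual algorithm with step size `δ`, penalty `ρ`
and weights `w`. The sums over in-neighbours are written over all agents, as `w i j = 0` otherwise. -/
def Game.step {N d m : ℕ} {n : Fin N → ℕ} (G : Game N d m n) (w : Matrix (Fin N) (Fin N) ℝ)
    (ρ δ : ℝ) (S : State N d m n) : State N d m n where
  x := WithLp.toLp 2 (fun i =>
    S.x i - δ • G.Ftilde i (S.x i) (G.φ i (S.x i) + S.z i)
      - δ • G.Gx ρ i ((N : ℝ) • G.c i (S.x i) + S.y i) (S.lam i))
  lam := fun i => ∑ j, w i j • S.lam j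
    + δ • Glam ρ ((N : ℝ) • G.c i (S.x i) + S.y i) (S.lam i)
  z := fun i => ∑ j, w i j • S.z j + ∑ j, w i j • G.φ j (S.x j) - G.φ i (S.x i)
  y := fun i => ∑ j, w i j • S.y j + ∑ j, w i j • ((N : ℝ) • G.c j (S.x j))
    - (N : ℝ) • G.c i (S.x i)

/-- Admissible initial states: nonnegative multipliers and zero-mean trackers. -/
structure State.Admissible {N d m : ℕ} {n : Fin N → ℕ} (S : State N d m n) : Prop where
  lam_nonneg : ∀ i l, 0 ≤ S.lam i l
  sum_z : ∑ i, S.z i = 0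
  sum_y : ∑ i, S.y i = 0

/-- Communication network: a strongly connected digraph (`E.Adj j i` means that `i` receives from
`j`; each agent is an in-neighbour of itself) with a compatible doubly stochastic weight matrix. -/
structure IsNetwork {N : ℕ} (E : Digraph (Fin N)) (w : Matrix (Fin N) (Fin N) ℝ) : Prop where
  self_adj : ∀ i, E.Adj i i
  pos_of_adj : ∀ i j, E.Adj j i → 0 < w i j
  zero_of_not_adj : ∀ i j, ¬ E.Adj j i → w i j = 0
  strongly_connected : ∀ i j, Relation.ReflTransGen E.Adj i j
  doubly_stochastic : w ∈ doublyStochastic ℝ (Fin N)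

end AggregativeGame

end

/-! Write `P` for the nonnegative part. A pair with `F x + Aᵀy = 0` and `P (ρ(Ax - b) + y) = y` is a
KKT pair, and KKT pairs are the zeros of the augmented primal-dual operator `(F x + Aᵀp, (y -
p)/ρ)`, `p = P (ρ(Ax - b) + y)`. In the Euclidean metric this operator controls only `x` and `y -
p`. In the metric `α(‖x‖² + ‖y‖²) + 2⟪y, Ax⟫` the cross term adds `‖Aᵀy‖² ≥ κ₁‖y‖²`, and the
operator becomes strongly monotone (`exists_primalDualBilin_ge`). Small Euler steps then contract,
so a KKT pair exists by Banach's theorem (`exists_primalDual_equilibrium`). Its primal part solves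
the variational inequality (`isVariationalGNE_of_kkt`); strong monotonicity gives uniqueness, and
convexity of each own cost gives the Nash property.

For the algorithm, the estimates `φ_i(x_i) + z_i` and `N c_i(x_i) + y_i` have exactly `σ(x)` and `Ax
- b` as averages. Hence `x` and the mean multiplier perform an Euler step of the same operator,
perturbed by the disagreement between agents (`exists_perturbed_step`). The disagreement shrinks by
a factor `σ < 1` up to terms of order `δ` (`disagreement_step_le`). For small `δ` the sum of the
metric and the squared disagreement contracts by `1 - κδ` (`exists_two_timescale_rate`). -/

namespace AggregativeGame

/-! ### A two-time-scale contraction estimate -/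

/-- If `V` decreases at rate `c δ` up to coupling terms and `b` contracts by the factor `σ < 1` up to
terms of order `δ`, then `V + b²` contracts by a factor `1 - κ δ`. -/
theorem exists_two_timescale_rate {c L σ M : ℝ} (hc : 0 < c) (hL : 0 ≤ L) (hσ₀ : 0 ≤ σ)
    (hσ : σ < 1) (hM : 0 < M) :
    ∃ δbar : ℝ, 0 < δbar ∧ ∃ κ : ℝ, 0 < κ ∧ ∀ δ : ℝ, 0 < δ → δ < δbar →
      ∀ a b V V' b' : ℝ, 0 ≤ a → 0 ≤ b → 0 ≤ b' → V ≤ M * a ^ 2 →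
        V' ≤ V - c * δ * a ^ 2 + δ * L * a * b + δ ^ 2 * L * (a + b) ^ 2 →
        b' ≤ σ * b + δ * L * (a + b) →
        V' + b' ^ 2 ≤ (1 - κ * δ) * (V + b ^ 2) := by
  have hσ2 : 0 < 1 - σ ^ 2 := by nlinarith
  -- `R` collects the terms of order `δ²`, the extra `1` keeping it positive. `K` collects every
  -- term `δ b²`: Young's inequality, the expansion of `b' ^ 2`, and `R`.
  set R : ℝ := 2 * (L + L ^ 2) + 1 with hR
  have hRpos : 0 < R := by positivity
  set K : ℝ := 9 * L ^ 2 / c + 2 * L + R with hK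
  have hKpos : 0 < K := by positivity
  -- Budget: of the decay `c δ a²`, a quarter pays for Young, a quarter for the `δ²` terms, and half
  -- remains for `κ δ V`. Of the gap `(1 - σ²) b²`, half pays for `δ K b²` and half for `κ δ b²`.
  refine ⟨min 1 (min (c / (4 * R)) ((1 - σ ^ 2) / (2 * K))), by positivity,
    min (c / (2 * M)) ((1 - σ ^ 2) / 2), by positivity, ?_⟩
  intro δ hδ hδb a b V V' b' ha hb hb' hV hV' hbb
  obtain ⟨h1, h2, h3⟩ : δ < 1 ∧ δ < c / (4 * R) ∧ δ < (1 - σ ^ 2) / (2 * K) := by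
    simpa [lt_min_iff] using hδb
  rw [lt_div_iff₀ (by positivity)] at h2 h3
  set κ := min (c / (2 * M)) ((1 - σ ^ 2) / 2) with hκ
  have hκpos : 0 < κ := by positivity
  have hκ1 : κ * M ≤ c / 2 := by
    have : κ ≤ c / (2 * M) := min_le_left _ _
    rw [le_div_iff₀ (by positivity)] at this
    linarith
  have hκ2 : κ ≤ (1 - σ ^ 2) / 2 := min_le_right _ _
  have hsq : (a + b) ^ 2 ≤ 2 * (a ^ 2 + b ^ 2) := by nlinarith [sq_nonneg (a - b)]
  have hb2 : b' ^ 2 ≤ (σ * b + δ * L * (a + b)) ^ 2 := pow_le_pow_left₀ hb' hbb 2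
  have hδL : 0 ≤ δ * L := by positivity
  have hb3 : b' ^ 2 ≤ σ ^ 2 * b ^ 2 + 2 * (δ * L) * (a * b + b ^ 2)
      + δ ^ 2 * L ^ 2 * (2 * (a ^ 2 + b ^ 2)) := by
    have e1 : σ * (δ * L * (a * b + b ^ 2)) ≤ 1 * (δ * L * (a * b + b ^ 2)) :=
      mul_le_mul_of_nonneg_right hσ.le (by positivity)
    have e2 : δ ^ 2 * L ^ 2 * (a + b) ^ 2 ≤ δ ^ 2 * L ^ 2 * (2 * (a ^ 2 + b ^ 2)) :=
      mul_le_mul_of_nonneg_left hsq (by positivity)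
    nlinarith
  have hV3 : δ ^ 2 * L * (a + b) ^ 2 ≤ δ ^ 2 * L * (2 * (a ^ 2 + b ^ 2)) :=
    mul_le_mul_of_nonneg_left hsq (by positivity)
  -- The factor `3` is one coupling term from `V'` and two from the cross term in `b' ^ 2`.
  have hyoung : 3 * L * (a * b) ≤ c / 4 * a ^ 2 + 9 * L ^ 2 / c * b ^ 2 := by
    have h : c / 4 * a ^ 2 + 9 * L ^ 2 / c * b ^ 2 - 3 * L * (a * b)
        = (c * a / 2 - 3 * L * b) ^ 2 / c := by
      field_simp
      ring
    have : 0 ≤ (c * a / 2 - 3 * L * b) ^ 2 / c := by positivity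
    linarith
  have hyoung' := mul_le_mul_of_nonneg_left hyoung hδ.le
  have hA : δ * (δ * R) * a ^ 2 ≤ δ * (c / 4) * a ^ 2 := by
    gcongr
    linarith
  have hδ2 : δ * δ ≤ δ := by nlinarith
  have hB : δ * δ * R * b ^ 2 ≤ δ * R * b ^ 2 := by gcongr
  have hB2 : δ * K * b ^ 2 ≤ (1 - σ ^ 2) / 2 * b ^ 2 := by
    gcongr
    linarith
  have hC : κ * δ * V ≤ δ * (c / 2) * a ^ 2 := by
    calc κ * δ * V ≤ κ * δ * (M * a ^ 2) := by gcongr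
      _ = δ * (κ * M) * a ^ 2 := by ring
      _ ≤ δ * (c / 2) * a ^ 2 := by gcongr
  have hD : κ * δ * b ^ 2 ≤ (1 - σ ^ 2) / 2 * b ^ 2 := by
    gcongr
    calc κ * δ ≤ κ * 1 := by gcongr
      _ ≤ _ := by rw [mul_one]; exact hκ2
  have hpos : 0 ≤ δ * δ * (a ^ 2 + b ^ 2) := by positivity
  rw [hK] at hB2
  have hRx : δ * δ * R * (a ^ 2 + b ^ 2)
      = δ ^ 2 * L * (2 * (a ^ 2 + b ^ 2)) + δ ^ 2 * L ^ 2 * (2 * (a ^ 2 + b ^ 2))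
        + δ * δ * (a ^ 2 + b ^ 2) := by rw [hR]; ring
  linear_combination hV' + hb3 + hV3 + hyoung' + hA + hB + hB2 + hC + hD + hpos - hRx

/-! ### The primal-dual quadratic form -/

section PrimalDual

variable {X Y : Type*} [NormedAddCommGroup X] [InnerProductSpace ℝ X]
  [NormedAddCommGroup Y] [InnerProductSpace ℝ Y]

/-- The quadratic form `α (‖x‖² + ‖y‖²) + 2 ⟪y, A x⟫`. -/
def primalDualForm (A : X →L[ℝ] Y) (α : ℝ) (x : X) (y : Y) : ℝ :=
  α * (‖x‖ ^ 2 + ‖y‖ ^ 2) + 2 * inner ℝ y (A x)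

/-- The symmetric bilinear form polar to `primalDualForm`. -/
def primalDualBilin (A : X →L[ℝ] Y) (α : ℝ) (x : X) (y : Y) (p : X) (q : Y) : ℝ :=
  α * inner ℝ x p + α * inner ℝ y q + inner ℝ y (A p) + inner ℝ q (A x)

theorem primalDualForm_sub_smul (A : X →L[ℝ] Y) (α δ : ℝ) (x p : X) (y q : Y) :
    primalDualForm A α (x - δ • p) (y - δ • q) =
      primalDualForm A α x y - 2 * δ * primalDualBilin A α x y p q
        + δ ^ 2 * primalDualForm A α p q := by
  simp only [primalDualForm, primalDualBilin, ← real_inner_self_eq_norm_sq, map_sub, map_smul,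
    inner_sub_left, inner_sub_right, inner_smul_left, inner_smul_right, real_inner_comm x p,
    real_inner_comm y q, RCLike.conj_to_real]
  ring

theorem primalDualBilin_add (A : X →L[ℝ] Y) (α : ℝ) (x p e : X) (y q h : Y) :
    primalDualBilin A α x y (p + e) (q + h) =
      primalDualBilin A α x y p q + primalDualBilin A α x y e h := by
  simp only [primalDualBilin, map_add, inner_add_left, inner_add_right]
  ring

theorem abs_inner_map_le (A : X →L[ℝ] Y) (x : X) (y : Y) :
    |inner ℝ y (A x)| ≤ ‖A‖ * ‖x‖ * ‖y‖ := by
  calc |inner ℝ y (A x)| ≤ ‖y‖ * ‖A x‖ := abs_real_inner_le_norm _ _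
    _ ≤ ‖y‖ * (‖A‖ * ‖x‖) := by gcongr; exact A.le_opNorm x
    _ = _ := by ring

theorem le_primalDualForm (A : X →L[ℝ] Y) {α : ℝ} (hα : ‖A‖ + 1 ≤ α) (x : X) (y : Y) :
    ‖x‖ ^ 2 + ‖y‖ ^ 2 ≤ primalDualForm A α x y := by
  have h := (abs_le.mp (abs_inner_map_le A x y)).1
  have h1 : 2 * (‖A‖ * ‖x‖ * ‖y‖) ≤ ‖A‖ * (‖x‖ ^ 2 + ‖y‖ ^ 2) := by
    nlinarith [norm_nonneg A, mul_nonneg (norm_nonneg A) (sq_nonneg (‖x‖ - ‖y‖))]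
  have h2 : (‖A‖ + 1) * (‖x‖ ^ 2 + ‖y‖ ^ 2) ≤ α * (‖x‖ ^ 2 + ‖y‖ ^ 2) := by gcongr
  unfold primalDualForm
  linarith

theorem primalDualForm_le (A : X →L[ℝ] Y) {α : ℝ} (hα : 0 ≤ α) (x : X) (y : Y) :
    primalDualForm A α x y ≤ (α + ‖A‖) * (‖x‖ + ‖y‖) ^ 2 := by
  have h := (abs_le.mp (abs_inner_map_le A x y)).2
  have := norm_nonneg A
  have h1 : 0 ≤ α * (‖x‖ * ‖y‖) := by positivity
  have h2 : 0 ≤ ‖A‖ * (‖x‖ ^ 2 + ‖y‖ ^ 2) := by positivity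
  unfold primalDualForm
  nlinarith

theorem neg_primalDualBilin_le (A : X →L[ℝ] Y) {α : ℝ} (hα : 0 ≤ α) (x e : X) (y h : Y) :
    -primalDualBilin A α x y e h ≤ (α + ‖A‖) * ((‖x‖ + ‖y‖) * (‖e‖ + ‖h‖)) := by
  have h1 := (abs_le.mp (abs_inner_map_le A e y)).1
  have h2 := (abs_le.mp (abs_inner_map_le A x h)).1
  have h3 := mul_le_mul_of_nonneg_left (abs_le.mp (abs_real_inner_le_norm x e)).1 hα
  have h4 := mul_le_mul_of_nonneg_left (abs_le.mp (abs_real_inner_le_norm y h)).1 hα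
  have := norm_nonneg A
  have h5 : 0 ≤ α * (‖x‖ * ‖h‖) := by positivity
  have h6 : 0 ≤ α * (‖y‖ * ‖e‖) := by positivity
  have h7 : 0 ≤ ‖A‖ * (‖x‖ * ‖e‖) := by positivity
  have h8 : 0 ≤ ‖A‖ * (‖y‖ * ‖h‖) := by positivity
  unfold primalDualBilin
  nlinarith

variable {A : X →L[ℝ] Y} {B : Y →L[ℝ] X}

/-- Strong monotonicity of the augmented primal-dual operator in the metric of `primalDualForm`. -/
theorem exists_primalDualBilin_ge (hAB : ∀ x y, inner ℝ (B y) x = inner ℝ y (A x))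
    {κ μ ρ L : ℝ} (hκ : 0 < κ) (hB : ∀ y, κ * ‖y‖ ^ 2 ≤ ‖B y‖ ^ 2) (hμ : 0 < μ) (hρ : 0 < ρ) :
    ∃ α : ℝ, ‖A‖ + 1 ≤ α ∧ ∃ c : ℝ, 0 < c ∧ ∀ (x f : X) (y g : Y),
      μ * ‖x‖ ^ 2 ≤ inner ℝ f x → ‖f‖ ≤ L * ‖x‖ → ‖g‖ ^ 2 ≤ inner ℝ g (ρ • A x + y) →
        c * (‖x‖ ^ 2 + ‖y‖ ^ 2) ≤ primalDualBilin A α x y (f + B g) (ρ⁻¹ • (y - g)) := by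
  set a := ‖A‖
  set b := ‖B‖
  -- The thresholds let `α μ ‖x‖²` and `(α / ρ) ‖g - y‖²` absorb what `e1`, `e2`, `e3` cost in `x`
  -- and in `g - y`, with `κ / 2` left over for `x`.
  set α₁ : ℝ := (b ^ 2 * L ^ 2 / κ + a / (2 * ρ) + κ / 2) / μ
  set α₂ : ℝ := (b ^ 4 / κ + a / (2 * ρ)) * ρ
  have ha : 0 ≤ a := norm_nonneg _
  have hb : 0 ≤ b := norm_nonneg _
  refine ⟨max (a + 1) (max α₁ α₂), le_max_left _ _, κ / 2, by positivity, ?_⟩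
  intro x f y g hf hfL hg
  set α := max (a + 1) (max α₁ α₂)
  have hα0 : a + 1 ≤ α := le_max_left _ _
  have hαpos : 0 < α := by linarith
  have hα1 : b ^ 2 * L ^ 2 / κ + a / (2 * ρ) + κ / 2 ≤ α * μ := by
    have : α₁ ≤ α := (le_max_left _ _).trans (le_max_right _ _)
    exact (div_le_iff₀ hμ).mp this
  have hα2 : b ^ 4 / κ + a / (2 * ρ) ≤ α / ρ := by
    have : α₂ ≤ α := (le_max_right _ _).trans (le_max_right _ _)
    exact (le_div_iff₀ hρ).mpr this
  set w := g - y with hw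
  have hg' : g = y + w := by rw [hw]; abel
  -- The difference of the two sides is `(⟪g, ρ A x + y⟫ - ‖g‖²) / ρ`, so this is exactly firm
  -- nonexpansiveness.
  have hdiag : (1 / ρ) * ‖w‖ ^ 2 ≤ inner ℝ x (B g) + inner ℝ y (ρ⁻¹ • (y - g)) := by
    have h1 : inner ℝ x (B g) = inner ℝ g (A x) := by rw [real_inner_comm, hAB]
    rw [inner_add_right, inner_smul_right] at hg
    have h2 : inner ℝ y (ρ⁻¹ • (y - g)) = ρ⁻¹ * (‖y‖ ^ 2 - inner ℝ g y) := by
      rw [inner_smul_right, inner_sub_right, real_inner_self_eq_norm_sq, real_inner_comm y g]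
    have h3 : ‖w‖ ^ 2 = ‖g‖ ^ 2 - 2 * inner ℝ g y + ‖y‖ ^ 2 := by
      rw [hw, norm_sub_sq_real]
    rw [h1, h2, h3, ← sub_nonneg]
    have : inner ℝ g (A x) + ρ⁻¹ * (‖y‖ ^ 2 - inner ℝ g y)
        - 1 / ρ * (‖g‖ ^ 2 - 2 * inner ℝ g y + ‖y‖ ^ 2)
        = (ρ * inner ℝ g (A x) + inner ℝ g y - ‖g‖ ^ 2) / ρ := by
      field_simp
      ring
    rw [this]
    apply div_nonneg _ hρ.le
    linarith
  -- The only source of decay in `y`: `‖B y‖² ≥ κ ‖y‖²`. The bounds `e1` and `e2` each spend `κ / 4`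
  -- of it, leaving `κ / 2`.
  have hcross1 : inner ℝ y (A (f + B g)) =
      inner ℝ (B y) f + ‖B y‖ ^ 2 + inner ℝ (B y) (B w) := by
    rw [← hAB, hg', map_add, inner_add_right, inner_add_right, real_inner_self_eq_norm_sq]
    ring
  have hcross2 : inner ℝ (ρ⁻¹ • (y - g)) (A x) = -(ρ⁻¹ * inner ℝ w (A x)) := by
    have : y - g = -w := by rw [hw]; abel
    rw [this, inner_smul_left, inner_neg_left]
    simp
  have hBy : ‖B y‖ ≤ b * ‖y‖ := B.le_opNorm y
  have hBw : ‖B w‖ ≤ b * ‖w‖ := B.le_opNorm w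
  have e1 : -(b ^ 2 * L ^ 2 / κ * ‖x‖ ^ 2 + κ / 4 * ‖y‖ ^ 2) ≤ inner ℝ (B y) f := by
    have h1 := (abs_le.mp (abs_real_inner_le_norm (B y) f)).1
    have h2 : ‖B y‖ * ‖f‖ ≤ (b * ‖y‖) * (L * ‖x‖) := by gcongr
    have h3 : b ^ 2 * L ^ 2 / κ * ‖x‖ ^ 2 + κ / 4 * ‖y‖ ^ 2 - (b * ‖y‖) * (L * ‖x‖)
        = (b * L * ‖x‖ - κ / 2 * ‖y‖) ^ 2 / κ := by
      field_simp
      ring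
    have h4 : 0 ≤ (b * L * ‖x‖ - κ / 2 * ‖y‖) ^ 2 / κ := by positivity
    linarith
  have e2 : -(b ^ 4 / κ * ‖w‖ ^ 2 + κ / 4 * ‖y‖ ^ 2) ≤ inner ℝ (B y) (B w) := by
    have h1 := (abs_le.mp (abs_real_inner_le_norm (B y) (B w))).1
    have h2 : ‖B y‖ * ‖B w‖ ≤ (b * ‖y‖) * (b * ‖w‖) := by gcongr
    have h3 : b ^ 4 / κ * ‖w‖ ^ 2 + κ / 4 * ‖y‖ ^ 2 - (b * ‖y‖) * (b * ‖w‖)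
        = (b ^ 2 * ‖w‖ - κ / 2 * ‖y‖) ^ 2 / κ := by
      field_simp
      ring
    have h4 : 0 ≤ (b ^ 2 * ‖w‖ - κ / 2 * ‖y‖) ^ 2 / κ := by positivity
    linarith
  have e3 : ρ⁻¹ * inner ℝ w (A x) ≤ a / (2 * ρ) * (‖x‖ ^ 2 + ‖w‖ ^ 2) := by
    have h1 := (abs_le.mp (abs_inner_map_le A x w)).2
    have h2 : a * ‖x‖ * ‖w‖ ≤ a / 2 * (‖x‖ ^ 2 + ‖w‖ ^ 2) := by
      nlinarith [mul_nonneg ha (sq_nonneg (‖x‖ - ‖w‖))]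
    calc ρ⁻¹ * inner ℝ w (A x) ≤ ρ⁻¹ * (a / 2 * (‖x‖ ^ 2 + ‖w‖ ^ 2)) := by gcongr; linarith
      _ = _ := by field_simp
  have d1 := mul_le_mul_of_nonneg_left hdiag hαpos.le
  have d2 := mul_le_mul_of_nonneg_left hf hαpos.le
  have d3 := mul_le_mul_of_nonneg_right hα1 (sq_nonneg ‖x‖)
  have d4 := mul_le_mul_of_nonneg_right hα2 (sq_nonneg ‖w‖)
  have hBy2 := hB y
  unfold primalDualBilin
  rw [hcross1, hcross2, inner_add_right, real_inner_comm f x]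
  linear_combination d1 + d2 + d3 + d4 + e1 + e2 + e3 + hBy2

/-- One perturbed Euler step of the augmented primal-dual flow. -/
theorem exists_primalDual_step (hAB : ∀ x y, inner ℝ (B y) x = inner ℝ y (A x))
    {κ μ ρ L : ℝ} (hκ : 0 < κ) (hB : ∀ y, κ * ‖y‖ ^ 2 ≤ ‖B y‖ ^ 2) (hμ : 0 < μ) (hρ : 0 < ρ)
    (hL : 0 ≤ L) :
    ∃ α : ℝ, ‖A‖ + 1 ≤ α ∧ ∃ c : ℝ, 0 < c ∧ ∃ K : ℝ, 0 ≤ K ∧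
      ∀ (δ : ℝ) (x f e : X) (y g h : Y), 0 < δ →
      μ * ‖x‖ ^ 2 ≤ inner ℝ f x → ‖f‖ ≤ L * ‖x‖ → ‖g‖ ^ 2 ≤ inner ℝ g (ρ • A x + y) →
        primalDualForm A α (x - δ • (f + B g + e)) (y - δ • (ρ⁻¹ • (y - g) + h)) ≤
          primalDualForm A α x y - c * δ * (‖x‖ + ‖y‖) ^ 2
            + δ * K * (‖x‖ + ‖y‖) * (‖e‖ + ‖h‖)
            + δ ^ 2 * K * ((‖x‖ + ‖y‖) + (‖e‖ + ‖h‖)) ^ 2 ∧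
        ‖f + B g + e‖ ≤ K * ((‖x‖ + ‖y‖) + (‖e‖ + ‖h‖)) := by
  obtain ⟨α, hα, c, hc, H⟩ := exists_primalDualBilin_ge (L := L) hAB hκ hB hμ hρ
  have ha : 0 ≤ ‖A‖ := norm_nonneg _
  have hα0 : 0 ≤ α := by linarith
  set D : ℝ := 1 + L + (‖B‖ + ρ⁻¹) * (ρ * ‖A‖ + 1) + ρ⁻¹ with hD
  have hD1 : 1 + L + ‖B‖ * (ρ * ‖A‖ + 1) ≤ D := by
    rw [hD]
    have : 0 ≤ ρ⁻¹ * (ρ * ‖A‖ + 1) + ρ⁻¹ := by positivity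
    linarith
  have hDpos : 0 ≤ D := by positivity
  -- The three entries bound the length of the step, the first-order effect of the perturbation and
  -- the second-order Euler term.
  set K : ℝ := max D (max (2 * (α + ‖A‖)) ((α + ‖A‖) * D ^ 2)) with hK
  have hK1 : D ≤ K := le_max_left _ _
  have hK2 : 2 * (α + ‖A‖) ≤ K := (le_max_left _ _).trans (le_max_right _ _)
  have hK3 : (α + ‖A‖) * D ^ 2 ≤ K := (le_max_right _ _).trans (le_max_right _ _)
  refine ⟨α, hα, c, hc, K, hDpos.trans hK1, ?_⟩
  intro δ x f e y g h hδ hf hfL hg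
  have hgn : ‖g‖ ≤ (ρ * ‖A‖ + 1) * (‖x‖ + ‖y‖) := by
    have h1 : ‖g‖ ^ 2 ≤ ‖g‖ * ‖ρ • A x + y‖ := hg.trans (real_inner_le_norm _ _)
    have h2 : ‖ρ • A x + y‖ ≤ ρ * (‖A‖ * ‖x‖) + ‖y‖ := by
      refine (norm_add_le _ _).trans ?_
      rw [norm_smul, Real.norm_of_nonneg hρ.le]
      gcongr
      exact A.le_opNorm x
    have h3 : ‖g‖ ≤ ‖ρ • A x + y‖ := by
      by_contra hlt
      push Not at hlt
      nlinarith [norm_nonneg (ρ • A x + y)]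
    have : 0 ≤ ρ * ‖A‖ * ‖y‖ := by positivity
    nlinarith [norm_nonneg x]
  have hp0 : ‖f + B g + e‖ ≤ L * ‖x‖ + ‖B‖ * ((ρ * ‖A‖ + 1) * (‖x‖ + ‖y‖)) + ‖e‖ := by
    refine (norm_add₃_le).trans ?_
    gcongr
    exact (B.le_opNorm g).trans (by gcongr)
  have hq0 : ‖ρ⁻¹ • (y - g) + h‖ ≤ ρ⁻¹ * (‖y‖ + (ρ * ‖A‖ + 1) * (‖x‖ + ‖y‖)) + ‖h‖ := by
    refine (norm_add_le _ _).trans ?_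
    rw [norm_smul, Real.norm_of_nonneg (inv_nonneg.mpr hρ.le)]
    gcongr
    exact (norm_sub_le _ _).trans (by gcongr)
  set S := (‖x‖ + ‖y‖) + (‖e‖ + ‖h‖) with hS
  have hx := norm_nonneg x
  have hy := norm_nonneg y
  have hen := norm_nonneg e
  have hhn := norm_nonneg h
  have hSn : 0 ≤ S := by positivity
  have i1 : L * ‖x‖ ≤ L * S := by gcongr; linarith
  have i2 : ‖B‖ * ((ρ * ‖A‖ + 1) * (‖x‖ + ‖y‖)) ≤ ‖B‖ * ((ρ * ‖A‖ + 1) * S) := by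
    gcongr; linarith
  have i3 : ρ⁻¹ * (‖y‖ + (ρ * ‖A‖ + 1) * (‖x‖ + ‖y‖)) ≤ ρ⁻¹ * (S + (ρ * ‖A‖ + 1) * S) := by
    gcongr <;> linarith
  have hpq : ‖f + B g + e‖ + ‖ρ⁻¹ • (y - g) + h‖ ≤ D * S := by
    have : ‖e‖ + ‖h‖ ≤ S := by linarith
    rw [hD]
    linarith
  have hp : ‖f + B g + e‖ ≤ K * S := by
    have h1 := norm_nonneg (ρ⁻¹ • (y - g) + h)
    have h2 : D * S ≤ K * S := by gcongr
    linarith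
  refine ⟨?_, hp⟩
  rw [primalDualForm_sub_smul, primalDualBilin_add]
  have t1 := H x f y g hf hfL hg
  have t2 := neg_primalDualBilin_le A hα0 x e y h
  have t3 := primalDualForm_le A hα0 (f + B g + e) (ρ⁻¹ • (y - g) + h)
  have t4 : (α + ‖A‖) * (‖f + B g + e‖ + ‖ρ⁻¹ • (y - g) + h‖) ^ 2 ≤ K * S ^ 2 := by
    calc _ ≤ (α + ‖A‖) * (D * S) ^ 2 := by gcongr
      _ = (α + ‖A‖) * D ^ 2 * S ^ 2 := by ring
      _ ≤ _ := by gcongr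
  have t5 : δ ^ 2 * primalDualForm A α (f + B g + e) (ρ⁻¹ • (y - g) + h) ≤ δ ^ 2 * (K * S ^ 2) :=
    mul_le_mul_of_nonneg_left (t3.trans t4) (sq_nonneg δ)
  have t6 : 2 * ((α + ‖A‖) * ((‖x‖ + ‖y‖) * (‖e‖ + ‖h‖)))
      ≤ K * ((‖x‖ + ‖y‖) * (‖e‖ + ‖h‖)) := by
    rw [← mul_assoc]
    gcongr
  -- The factor `2` of the polarised first-order term turns the sum of squares into the square of
  -- the sum.
  have t7 : c * (‖x‖ + ‖y‖) ^ 2 ≤ 2 * (c * (‖x‖ ^ 2 + ‖y‖ ^ 2)) := by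
    linear_combination mul_nonneg hc.le (sq_nonneg (‖x‖ - ‖y‖))
  have t8 := mul_le_mul_of_nonneg_left t1 hδ.le
  have t9 := mul_le_mul_of_nonneg_left t2 hδ.le
  have t10 := mul_le_mul_of_nonneg_left t6 hδ.le
  have t11 := mul_le_mul_of_nonneg_left t7 hδ.le
  linear_combination t5 + 2 * t8 + 2 * t9 + t10 + t11

/-- Existence of a zero of the augmented primal-dual operator. -/
theorem exists_primalDual_equilibrium [CompleteSpace X] [CompleteSpace Y]
    (hAB : ∀ x y, inner ℝ (B y) x = inner ℝ y (A x))
    {κ μ ρ L : ℝ} (hκ : 0 < κ) (hB : ∀ y, κ * ‖y‖ ^ 2 ≤ ‖B y‖ ^ 2) (hμ : 0 < μ) (hρ : 0 < ρ)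
    (hL : 0 ≤ L) (b : Y) (F : X → X) (P : Y → Y)
    (hF : ∀ x x', μ * ‖x - x'‖ ^ 2 ≤ inner ℝ (F x - F x') (x - x'))
    (hFL : ∀ x x', ‖F x - F x'‖ ≤ L * ‖x - x'‖)
    (hP : ∀ u v, ‖P u - P v‖ ^ 2 ≤ inner ℝ (P u - P v) (u - v)) :
    ∃ x y, F x + B (P (ρ • (A x - b) + y)) = 0 ∧ P (ρ • (A x - b) + y) = y := by
  obtain ⟨α, hα, c, hc, K, hK, H⟩ := exists_primalDual_step hAB hκ hB hμ hρ hL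
  have ha : 0 ≤ ‖A‖ := norm_nonneg _
  have hα0 : 0 ≤ α := by linarith
  -- Without a fast variable (`σ = 0`, `b = b' = 0`) the estimate says that the Euler map `T`
  -- contracts `U`.
  obtain ⟨δbar, hδbar, r, hr, Hr⟩ := exists_two_timescale_rate (σ := 0) (M := α + ‖A‖) hc hK le_rfl
    one_pos (by linarith)
  set δ := min (δbar / 2) (1 / (2 * r)) with hδdef
  have hδ : 0 < δ := by positivity
  have hδlt : δ < δbar := (min_le_left _ _).trans_lt (by linarith)
  have hδr : r * δ ≤ 1 / 2 := by
    have : δ ≤ 1 / (2 * r) := min_le_right _ _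
    rw [le_div_iff₀ (by positivity)] at this
    linarith
  set q := 1 - r * δ with hq
  have hq0 : 0 ≤ q := by linarith
  have hq1 : q < 1 := by
    have : 0 < r * δ := by positivity
    linarith
  let T : X × Y → X × Y := fun p =>
    (p.1 - δ • (F p.1 + B (P (ρ • (A p.1 - b) + p.2))),
      p.2 - δ • (ρ⁻¹ • (p.2 - P (ρ • (A p.1 - b) + p.2))))
  let U : X × Y → X × Y → ℝ := fun p p' => primalDualForm A α (p.1 - p'.1) (p.2 - p'.2)
  have hT : ∀ p p', U (T p) (T p') ≤ q * U p p' := by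
    intro p p'
    set g := P (ρ • (A p.1 - b) + p.2) with hgdef
    set g' := P (ρ • (A p'.1 - b) + p'.2) with hgdef'
    have hgg : ‖g - g'‖ ^ 2 ≤ inner ℝ (g - g') (ρ • A (p.1 - p'.1) + (p.2 - p'.2)) := by
      convert hP (ρ • (A p.1 - b) + p.2) (ρ • (A p'.1 - b) + p'.2) using 2
      rw [map_sub, smul_sub, smul_sub, smul_sub]
      abel
    have h1 := (H δ (p.1 - p'.1) (F p.1 - F p'.1) 0 (p.2 - p'.2) (g - g') 0 hδ
      (hF _ _) (hFL _ _) hgg).1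
    have e1 : (T p).1 - (T p').1 = (p.1 - p'.1) - δ • (F p.1 - F p'.1 + B (g - g') + 0) := by
      simp only [T, hgdef, hgdef', map_sub, smul_sub, smul_add, smul_zero]
      abel
    have e2 : (T p).2 - (T p').2 = (p.2 - p'.2) - δ • (ρ⁻¹ • (p.2 - p'.2 - (g - g')) + 0) := by
      simp only [T, hgdef, hgdef', smul_sub, smul_add, smul_zero]
      abel
    have h2 := Hr δ hδ hδlt (‖p.1 - p'.1‖ + ‖p.2 - p'.2‖) 0 (U p p') (U (T p) (T p')) 0
      (by positivity) le_rfl le_rfl (primalDualForm_le A hα0 _ _)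
      (by simp only [U]; rw [e1, e2]; simpa using h1) (by positivity)
    simpa using h2
  have hTk : ∀ k p p', U (T^[k] p) (T^[k] p') ≤ q ^ k * U p p' := by
    intro k
    induction k with
    | zero => intro p p'; simp
    | succ k ih =>
      intro p p'
      rw [Function.iterate_succ_apply', Function.iterate_succ_apply', pow_succ']
      calc _ ≤ q * U (T^[k] p) (T^[k] p') := hT _ _
        _ ≤ q * (q ^ k * U p p') := by gcongr; exact ih p p'
        _ = _ := by ring
  have hlow : ∀ p p' : X × Y, dist p p' ^ 2 ≤ U p p' := by
    intro p p'
    refine le_trans ?_ (le_primalDualForm A hα _ _)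
    rw [Prod.dist_eq, dist_eq_norm, dist_eq_norm]
    rcases max_cases ‖p.1 - p'.1‖ ‖p.2 - p'.2‖ with h | h <;> rw [h.1] <;>
      nlinarith [sq_nonneg ‖p.1 - p'.1‖, sq_nonneg ‖p.2 - p'.2‖]
  have hup : ∀ p p' : X × Y, U p p' ≤ (α + ‖A‖) * 4 * dist p p' ^ 2 := by
    intro p p'
    refine (primalDualForm_le A hα0 _ _).trans ?_
    have h1 : ‖p.1 - p'.1‖ ≤ dist p p' := by
      rw [Prod.dist_eq, ← dist_eq_norm]; exact le_max_left _ _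
    have h2 : ‖p.2 - p'.2‖ ≤ dist p p' := by
      rw [Prod.dist_eq, ← dist_eq_norm]; exact le_max_right _ _
    calc _ ≤ (α + ‖A‖) * (dist p p' + dist p p') ^ 2 := by gcongr
      _ = _ := by ring
  -- `U` is only equivalent to the squared product distance. A high enough iterate beats the
  -- equivalence constant; its fixed point is then fixed by `T` itself.
  obtain ⟨k, hk⟩ : ∃ k : ℕ, q ^ k * ((α + ‖A‖) * 4) ≤ 1 / 4 := by
    obtain ⟨k, hk⟩ := exists_pow_lt_of_lt_one (y := q)
      (show (0 : ℝ) < 1 / 4 / ((α + ‖A‖) * 4) by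
        have : 0 < α + ‖A‖ := by linarith
        positivity) hq1
    refine ⟨k, ?_⟩
    rw [lt_div_iff₀ (by linarith)] at hk
    exact hk.le
  have hcontr : ContractingWith (1 / 2) (T^[k]) := by
    refine ⟨by norm_num, LipschitzWith.of_dist_le_mul fun p p' => ?_⟩
    have h1 : dist (T^[k] p) (T^[k] p') ^ 2 ≤ (1 / 2 * dist p p') ^ 2 := by
      calc _ ≤ U (T^[k] p) (T^[k] p') := hlow _ _
        _ ≤ q ^ k * U p p' := hTk k p p'
        _ ≤ q ^ k * ((α + ‖A‖) * 4 * dist p p' ^ 2) := by gcongr; exact hup _ _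
        _ = q ^ k * ((α + ‖A‖) * 4) * dist p p' ^ 2 := by ring
        _ ≤ 1 / 4 * dist p p' ^ 2 := by gcongr
        _ = _ := by ring
    simpa using (sq_le_sq₀ dist_nonneg (by positivity)).mp h1
  have hfix := hcontr.isFixedPt_fixedPoint_iterate
  set p := ContractingWith.fixedPoint (T^[k]) hcontr
  refine ⟨p.1, p.2, ?_, ?_⟩
  · have h := congrArg Prod.fst hfix
    simp only [T, sub_eq_self, smul_eq_zero, hδ.ne', false_or] at h
    exact h
  · have h := congrArg Prod.snd hfix
    simp only [T, sub_eq_self, smul_eq_zero, hδ.ne', false_or, inv_eq_zero, hρ.ne'] at h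
    exact (sub_eq_zero.mp h).symm

end PrimalDual

/-! ### Averaging over the network -/

section Averaging

variable {N k : ℕ}

/-- The average of a family of vectors. -/
noncomputable def mean (v : Fin N → Vec k) : Vec k := (1 / (N : ℝ)) • ∑ i, v i

/-- The disagreement vector `(v_i - mean v)_i`. -/
noncomputable def deviation (v : Fin N → Vec k) : PiLp 2 (fun _ : Fin N => Vec k) :=
  WithLp.toLp 2 (fun i => v i - mean v)

theorem mean_add (v u : Fin N → Vec k) : mean (fun i => v i + u i) = mean v + mean u := by
  simp only [mean, Finset.sum_add_distrib, smul_add]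

theorem mean_const (hN : 0 < N) (c : Vec k) : mean (fun _ : Fin N => c) = c := by
  have : (N : ℝ) ≠ 0 := by positivity
  simp only [mean, Finset.sum_const, Finset.card_univ, Fintype.card_fin]
  rw [← Nat.cast_smul_eq_nsmul ℝ, smul_smul, one_div, inv_mul_cancel₀ this, one_smul]

theorem sum_eq_smul_mean (hN : 0 < N) (v : Fin N → Vec k) : ∑ i, v i = (N : ℝ) • mean v := by
  have : (N : ℝ) ≠ 0 := by positivity
  rw [mean, smul_smul, one_div, mul_inv_cancel₀ this, one_smul]

theorem norm_mean_le (hN : 0 < N) {v : Fin N → Vec k} {C : ℝ} (h : ∀ i, ‖v i‖ ≤ C) :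
    ‖mean v‖ ≤ C := by
  have hN' : (0 : ℝ) < N := by positivity
  rw [mean, norm_smul, Real.norm_of_nonneg (by positivity)]
  calc 1 / (N : ℝ) * ‖∑ i, v i‖ ≤ 1 / (N : ℝ) * (N * C) := by
        gcongr
        refine (norm_sum_le _ _).trans ((Finset.sum_le_sum fun i _ => h i).trans ?_)
        simp
    _ = C := by field_simp

theorem norm_toLp_le_of_le {ι : Type*} [Fintype ι] {β : ι → Type*}
    [∀ i, SeminormedAddCommGroup (β i)] (v : ∀ i, β i) {C : ℝ} (h : ∀ i, ‖v i‖ ≤ C)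
    (hC : 0 ≤ C) : ‖(WithLp.toLp 2 v : PiLp 2 β)‖ ≤ Fintype.card ι * C := by
  rw [PiLp.norm_eq_of_L2]
  refine Real.sqrt_le_iff.mpr ⟨by positivity, ?_⟩
  have h1 : ∑ i, ‖v i‖ ^ 2 ≤ Fintype.card ι * C ^ 2 := by
    refine (Finset.sum_le_sum fun i _ => pow_le_pow_left₀ (norm_nonneg _) (h i) 2).trans ?_
    simp
  refine h1.trans ?_
  have h2 : (Fintype.card ι : ℝ) ≤ (Fintype.card ι : ℝ) ^ 2 := by
    exact_mod_cast Nat.le_self_pow two_ne_zero _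
  rw [mul_pow]
  gcongr

theorem norm_sub_mean_le (v : Fin N → Vec k) (i : Fin N) : ‖v i - mean v‖ ≤ ‖deviation v‖ :=
  PiLp.norm_apply_le (deviation v) i

/-- Centring is an orthogonal projection: it lowers the sum of squares by `N ‖mean v‖²`. -/
theorem norm_deviation_le (hN : 0 < N) (v : Fin N → Vec k) :
    ‖deviation v‖ ≤ ‖(WithLp.toLp 2 v : PiLp 2 (fun _ : Fin N => Vec k))‖ := by
  rw [PiLp.norm_eq_of_L2, PiLp.norm_eq_of_L2]
  apply Real.sqrt_le_sqrt
  simp only [deviation, norm_sub_sq_real, Finset.sum_add_distrib, Finset.sum_sub_distrib,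
    ← Finset.mul_sum, ← sum_inner]
  rw [sum_eq_smul_mean hN v, real_inner_smul_left, real_inner_self_eq_norm_sq]
  simp only [Finset.sum_const, Finset.card_univ, Fintype.card_fin, nsmul_eq_mul]
  have : 0 ≤ (N : ℝ) * ‖mean v‖ ^ 2 := by positivity
  linarith

end Averaging

/-! ### Contraction of disagreement by the weight matrix -/

section Network

variable {N : ℕ} {E : Digraph (Fin N)} {w : Matrix (Fin N) (Fin N) ℝ}

/-- Each row is a probability vector, so the inner sum on the right is a variance; column sums equal
to one collapse the second moments to `∑ v_j²`. -/
theorem sum_sq_sub_sum_sq_mulVec (hw : w ∈ doublyStochastic ℝ (Fin N)) (v : Fin N → ℝ) :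
    ∑ i, v i ^ 2 - ∑ i, (w *ᵥ v) i ^ 2 = ∑ i, ∑ j, w i j * (v j - (w *ᵥ v) i) ^ 2 := by
  obtain ⟨-, hrow, hcol⟩ := mem_doublyStochastic_iff_sum.mp hw
  have h1 : ∑ i, ∑ j, w i j * v j ^ 2 = ∑ j, v j ^ 2 := by
    rw [Finset.sum_comm]
    simp [← Finset.sum_mul, hcol]
  have h2 : ∀ i, ∑ j, w i j * (v j - (w *ᵥ v) i) ^ 2
      = ∑ j, w i j * v j ^ 2 - (w *ᵥ v) i ^ 2 := by
    intro i
    have : ∀ j, w i j * (v j - (w *ᵥ v) i) ^ 2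
        = w i j * v j ^ 2 - 2 * (w *ᵥ v) i * (w i j * v j) + w i j * (w *ᵥ v) i ^ 2 :=
      fun j => by ring
    simp only [this, Finset.sum_add_distrib, Finset.sum_sub_distrib, ← Finset.mul_sum,
      ← Finset.sum_mul, hrow]
    have : ∑ j, w i j * v j = (w *ᵥ v) i := rfl
    rw [this]
    ring
  simp only [h2, Finset.sum_sub_distrib, h1]

/-- A nonzero zero-sum vector is strictly contracted by the weight matrix of a network. -/
theorem IsNetwork.sum_sq_mulVec_lt (hnet : IsNetwork E w) {v : Fin N → ℝ} (hv : ∑ i, v i = 0)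
    (hv0 : v ≠ 0) : ∑ i, (w *ᵥ v) i ^ 2 < ∑ i, v i ^ 2 := by
  have hw0 := (mem_doublyStochastic_iff_sum.mp hnet.doubly_stochastic).1
  have hid := sum_sq_sub_sum_sq_mulVec hnet.doubly_stochastic v
  have hnn : ∀ i j, 0 ≤ w i j * (v j - (w *ᵥ v) i) ^ 2 :=
    fun i j => mul_nonneg (hw0 i j) (sq_nonneg _)
  have hnn' : 0 ≤ ∑ i, ∑ j, w i j * (v j - (w *ᵥ v) i) ^ 2 :=
    Finset.sum_nonneg fun i _ => Finset.sum_nonneg fun j _ => hnn i j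
  by_contra hlt
  have hzero : ∑ i, ∑ j, w i j * (v j - (w *ᵥ v) i) ^ 2 = 0 := by linarith
  have hterm : ∀ i j, E.Adj j i → v j = (w *ᵥ v) i := by
    intro i j hij
    have h1 := (Finset.sum_eq_zero_iff_of_nonneg
      fun i _ => Finset.sum_nonneg fun j _ => hnn i j).mp hzero i (Finset.mem_univ i)
    have h2 := (Finset.sum_eq_zero_iff_of_nonneg fun j _ => hnn i j).mp h1 j (Finset.mem_univ j)
    have h3 := (mul_eq_zero.mp h2).resolve_left (hnet.pos_of_adj i j hij).ne'
    exact sub_eq_zero.mp (pow_eq_zero_iff two_ne_zero |>.mp h3)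
  -- Zero variance makes all in-neighbours of an agent agree. With the self-loop the agent agrees
  -- with them too, and strong connectivity spreads the value everywhere.
  have hconst : ∀ i j, v i = v j := by
    intro i j
    induction hnet.strongly_connected i j with
    | refl => rfl
    | tail _ hbc ih => rw [ih, hterm _ _ hbc, ← hterm _ _ (hnet.self_adj _)]
  apply hv0
  funext i
  have : (N : ℝ) * v i = 0 := by
    rw [← hv, Finset.sum_congr rfl fun j _ => hconst j i]
    simp
  have hN : (N : ℝ) ≠ 0 := by
    have := i.pos
    positivity
  simpa [hN] using this

/-- Compactness of the unit sphere of the zero-sum subspace makes the strict inequality uniform;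
`σ²` is the maximum there. If the sphere is empty, the subspace is trivial and `σ = 0` serves. -/
theorem IsNetwork.exists_contraction_scalar (hnet : IsNetwork E w) :
    ∃ σ : ℝ, 0 ≤ σ ∧ σ < 1 ∧ ∀ v : Fin N → ℝ, ∑ i, v i = 0 →
      ∑ i, (w *ᵥ v) i ^ 2 ≤ σ ^ 2 * ∑ i, v i ^ 2 := by
  let S : Set (EuclideanSpace ℝ (Fin N)) := Metric.sphere 0 1 ∩ {v | ∑ i, v i = 0}
  let f : EuclideanSpace ℝ (Fin N) → ℝ := fun v => ∑ i, (∑ j, w i j * v j) ^ 2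
  have hS : IsCompact S :=
    (isCompact_sphere 0 1).inter_right (isClosed_eq (by fun_prop) continuous_const)
  have hf : ContinuousOn f S := by
    apply Continuous.continuousOn
    fun_prop
  have hnorm : ∀ v : Fin N → ℝ, ‖(WithLp.toLp 2 v : EuclideanSpace ℝ (Fin N))‖ ^ 2 = ∑ i, v i ^ 2 :=
    fun v => by rw [EuclideanSpace.real_norm_sq_eq]
  have hmem : ∀ v : Fin N → ℝ, ∑ i, v i = 0 → v ≠ 0 →
      (‖(WithLp.toLp 2 v : EuclideanSpace ℝ (Fin N))‖⁻¹ • WithLp.toLp 2 v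
        : EuclideanSpace ℝ (Fin N)) ∈ S := by
    intro v hv hv0
    have hne : ‖(WithLp.toLp 2 v : EuclideanSpace ℝ (Fin N))‖ ≠ 0 := by
      simpa using hv0
    refine ⟨?_, ?_⟩
    · simp [norm_smul, hne]
    · simp [← Finset.mul_sum, hv]
  rcases S.eq_empty_or_nonempty with hemp | hne
  · refine ⟨0, le_rfl, one_pos, fun v hv => ?_⟩
    have hv0 : v = 0 := by
      by_contra hv0
      exact (hemp ▸ hmem v hv hv0 : _ ∈ (∅ : Set _)).elim
    simp [hv0]
  · obtain ⟨v₀, hv₀, hmax⟩ := hS.exists_isMaxOn hne hf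
    have hf0 : 0 ≤ f v₀ := Finset.sum_nonneg fun i _ => sq_nonneg _
    have hn0 : ‖v₀‖ = 1 := by simpa using hv₀.1
    refine ⟨√(f v₀), Real.sqrt_nonneg _, ?_, ?_⟩
    · rw [Real.sqrt_lt' one_pos, one_pow]
      have h := hnet.sum_sq_mulVec_lt (v := v₀.ofLp) hv₀.2 (by
        intro h
        have : v₀ = 0 := by ext i; exact congrFun h i
        simp [this] at hn0)
      rw [← hnorm v₀.ofLp] at h
      simpa [hn0, f, Matrix.mulVec, dotProduct] using h
    · intro v hv
      rw [Real.sq_sqrt hf0]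
      by_cases hv0 : v = 0
      · simp [hv0]
      have h := hmax (hmem v hv hv0)
      set r := ‖(WithLp.toLp 2 v : EuclideanSpace ℝ (Fin N))‖ with hr
      have hrpos : 0 < r := by
        rw [hr, norm_pos_iff]
        simpa using hv0
      have hfr : f (r⁻¹ • WithLp.toLp 2 v) = (r ^ 2)⁻¹ * ∑ i, (w *ᵥ v) i ^ 2 := by
        simp only [f, PiLp.smul_apply, smul_eq_mul, Finset.mul_sum, Matrix.mulVec, dotProduct]
        refine Finset.sum_congr rfl fun i _ => ?_
        rw [← inv_pow, ← mul_pow, Finset.mul_sum]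
        congr 1
        exact Finset.sum_congr rfl fun j _ => by ring
      have h' : (r ^ 2)⁻¹ * ∑ i, (w *ᵥ v) i ^ 2 ≤ f v₀ := hfr ▸ h
      rw [← hnorm v, ← hr]
      rwa [inv_mul_le_iff₀ (by positivity), mul_comm] at h'

/-- Mixing acts coordinatewise, so one `σ` serves every dimension `k`; it is used both for `d` and
for `m`. -/
theorem IsNetwork.exists_contraction (hnet : IsNetwork E w) :
    ∃ σ : ℝ, 0 ≤ σ ∧ σ < 1 ∧ ∀ (k : ℕ) (v : Fin N → Vec k), ∑ i, v i = 0 →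
      ‖(WithLp.toLp 2 (fun i => ∑ j, w i j • v j) : PiLp 2 (fun _ : Fin N => Vec k))‖ ≤
        σ * ‖(WithLp.toLp 2 v : PiLp 2 (fun _ : Fin N => Vec k))‖ := by
  obtain ⟨σ, hσ0, hσ1, H⟩ := hnet.exists_contraction_scalar
  refine ⟨σ, hσ0, hσ1, fun k v hv => ?_⟩
  rw [← sq_le_sq₀ (norm_nonneg _) (by positivity), mul_pow, PiLp.norm_sq_eq_of_L2,
    PiLp.norm_sq_eq_of_L2]
  simp only [EuclideanSpace.real_norm_sq_eq]
  rw [Finset.sum_comm, Finset.sum_comm (f := fun i l => v i l ^ 2), Finset.mul_sum]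
  refine Finset.sum_le_sum fun l _ => ?_
  have h := H (fun i => v i l) (by
    have := congrArg (fun u : Vec k => u l) hv
    simpa using this)
  simpa [Matrix.mulVec, dotProduct] using h

theorem sum_sum_smul_of_doublyStochastic {k : ℕ} (hw : w ∈ doublyStochastic ℝ (Fin N))
    (v : Fin N → Vec k) : ∑ i, ∑ j, w i j • v j = ∑ j, v j := by
  obtain ⟨-, -, hcol⟩ := mem_doublyStochastic_iff_sum.mp hw
  rw [Finset.sum_comm]
  simp [← Finset.sum_smul, hcol]

/-- A dynamic average consensus step with input `Δ`. -/
theorem IsNetwork.norm_deviation_step_le (hnet : IsNetwork E w) (hN : 0 < N) {k : ℕ} {σ : ℝ}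
    (H : ∀ v : Fin N → Vec k, ∑ i, v i = 0 →
      ‖(WithLp.toLp 2 (fun i => ∑ j, w i j • v j) : PiLp 2 (fun _ : Fin N => Vec k))‖ ≤
        σ * ‖(WithLp.toLp 2 v : PiLp 2 (fun _ : Fin N => Vec k))‖)
    (v Δ : Fin N → Vec k) {C : ℝ} (hΔ : ∀ i, ‖Δ i‖ ≤ C) (hC : 0 ≤ C) :
    ‖deviation (fun i => ∑ j, w i j • v j + Δ i)‖ ≤ σ * ‖deviation v‖ + N * C := by
  obtain ⟨-, hrow, -⟩ := mem_doublyStochastic_iff_sum.mp hnet.doubly_stochastic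
  have hmean : mean (fun i => ∑ j, w i j • v j) = mean v := by
    rw [mean, sum_sum_smul_of_doublyStochastic hnet.doubly_stochastic, mean]
  have hsum : ∑ i, (v i - mean v) = 0 := by
    rw [Finset.sum_sub_distrib, sum_eq_smul_mean hN v]
    simp [Nat.cast_smul_eq_nsmul]
  -- Column sums preserve the mean and row sums let it pass through the mixing, so the centred
  -- family is what gets mixed.
  have hsplit : deviation (fun i => ∑ j, w i j • v j + Δ i) =
      WithLp.toLp 2 (fun i => ∑ j, w i j • (v j - mean v)) + deviation Δ := by
    ext1 i
    simp only [deviation, mean_add, hmean, PiLp.add_apply, smul_sub, Finset.sum_sub_distrib,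
      ← Finset.sum_smul, hrow, one_smul]
    abel
  rw [hsplit]
  refine (norm_add_le _ _).trans (add_le_add (H _ hsum) ?_)
  refine (norm_deviation_le hN Δ).trans ?_
  simpa using norm_toLp_le_of_le Δ hΔ hC

end Network

/-! ### Projection on the nonnegative orthant -/

/-- Componentwise nonnegative part. -/
noncomputable def nonnegPart {m : ℕ} (v : Vec m) : Vec m := WithLp.toLp 2 (fun l => max (v l) 0)

theorem nonnegPart_firm {m : ℕ} (u v : Vec m) :
    ‖nonnegPart u - nonnegPart v‖ ^ 2 ≤ inner ℝ (nonnegPart u - nonnegPart v) (u - v) := by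
  rw [EuclideanSpace.real_norm_sq_eq, PiLp.inner_apply]
  refine Finset.sum_le_sum fun l _ => ?_
  simp only [nonnegPart, PiLp.sub_apply, RCLike.inner_apply, conj_trivial]
  rcases max_cases (u l) 0 with h | h <;> rcases max_cases (v l) 0 with h' | h' <;>
    rw [h.1, h'.1] <;> nlinarith

theorem norm_nonnegPart_sub_le {m : ℕ} (u v : Vec m) :
    ‖nonnegPart u - nonnegPart v‖ ≤ ‖u - v‖ := by
  have h := (nonnegPart_firm u v).trans (real_inner_le_norm _ _)
  by_contra hlt
  push Not at hlt
  nlinarith [norm_nonneg (u - v)]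

namespace Game

variable {N d m : ℕ} {n : Fin N → ℕ} (G : Game N d m n)

/-! ### Coupling constraints -/

/-- The linear map `x ↦ A x = ∑_i A_i x_i`. -/
noncomputable def couplingMap : Profile n →L[ℝ] Vec m :=
  LinearMap.toContinuousLinearMap
    { toFun := fun x => ∑ i, WithLp.toLp 2 ((G.A i) *ᵥ (fun k => x i k))
      map_add' := fun x y => by
        rw [← Finset.sum_add_distrib]
        refine Finset.sum_congr rfl fun i _ => ?_
        ext l
        simp [Matrix.mulVec, dotProduct, mul_add, Finset.sum_add_distrib]
      map_smul' := fun r x => by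
        rw [Finset.smul_sum]
        refine Finset.sum_congr rfl fun i _ => ?_
        ext l
        simp [Matrix.mulVec, dotProduct, Finset.mul_sum, mul_left_comm] }

/-- The linear map `y ↦ Aᵀ y`. -/
noncomputable def couplingMapT : Vec m →L[ℝ] Profile n :=
  LinearMap.toContinuousLinearMap
    { toFun := fun y => WithLp.toLp 2 (fun i => ∑ l, y l • (WithLp.toLp 2 (G.A i l) : Vec (n i)))
      map_add' := fun x y => by
        ext1 i
        simp [add_smul, Finset.sum_add_distrib]
      map_smul' := fun r x => by
        ext1 i
        simp [Finset.smul_sum, mul_smul] }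

theorem couplingMap_apply (x : Profile n) :
    G.couplingMap x = ∑ i, WithLp.toLp 2 ((G.A i) *ᵥ (fun k => x i k)) := rfl

theorem couplingMapT_apply (y : Vec m) (i : Fin N) :
    G.couplingMapT y i = ∑ l, y l • (WithLp.toLp 2 (G.A i l) : Vec (n i)) := rfl

theorem sum_c (x : Profile n) : ∑ i, G.c i (x i) = G.couplingMap x - ∑ i, G.b i := by
  simp only [c, Finset.sum_sub_distrib, couplingMap_apply]

theorem inner_couplingMapT (x : Profile n) (y : Vec m) :
    inner ℝ (G.couplingMapT y) x = inner ℝ y (G.couplingMap x) := by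
  rw [PiLp.inner_apply, couplingMap_apply, inner_sum]
  refine Finset.sum_congr rfl fun i _ => ?_
  rw [couplingMapT_apply, sum_inner, PiLp.inner_apply]
  refine Finset.sum_congr rfl fun l _ => ?_
  rw [real_inner_smul_left, PiLp.inner_apply]
  simp [Matrix.mulVec, dotProduct, mul_comm]

theorem norm_couplingMapT_sq (y : Vec m) :
    ‖G.couplingMapT y‖ ^ 2 = y.ofLp ⬝ᵥ ((G.matA * G.matA.transpose) *ᵥ y.ofLp) := by
  rw [← Matrix.mulVec_mulVec, Matrix.dotProduct_mulVec, Matrix.mulVec_transpose,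
    PiLp.norm_sq_eq_of_L2, dotProduct, Fintype.sum_sigma]
  refine Finset.sum_congr rfl fun i _ => ?_
  rw [EuclideanSpace.real_norm_sq_eq]
  refine Finset.sum_congr rfl fun k _ => ?_
  rw [couplingMapT_apply, sq]
  simp [Matrix.vecMul, dotProduct, matA]

/-- Turns `κ₁ I ≼ A Aᵀ` into the coercivity of `Aᵀ` that makes the multiplier converge. -/
theorem le_norm_couplingMapT_sq {κ : ℝ}
    (hA : (G.matA * G.matA.transpose - κ • (1 : Matrix (Fin m) (Fin m) ℝ)).PosSemidef)
    (y : Vec m) : κ * ‖y‖ ^ 2 ≤ ‖G.couplingMapT y‖ ^ 2 := by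
  have h := hA.dotProduct_mulVec_nonneg y.ofLp
  rw [norm_couplingMapT_sq, EuclideanSpace.real_norm_sq_eq]
  simp only [Matrix.sub_mulVec, Matrix.smul_mulVec, Matrix.one_mulVec, star_trivial,
    dotProduct_sub, dotProduct_smul, smul_eq_mul, sub_nonneg] at h
  have hn : ∑ l, y l ^ 2 = y.ofLp ⬝ᵥ y.ofLp := Finset.sum_congr rfl fun l _ => sq (y l)
  rw [hn]
  exact h

theorem _root_.AggregativeGame.Glam_eq (ρ : ℝ) (s₁ s₂ : Vec m) :
    Glam ρ s₁ s₂ = ρ⁻¹ • (nonnegPart (ρ • s₁ + s₂) - s₂) := by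
  ext l
  simp [Glam, nonnegPart]

/-! ### Gradients -/

variable {G} {β₁ β₂ β₃ : ℝ}

theorem continuous_of_norm_sub_le {E₁ E₂ E₃ : Type*} [NormedAddCommGroup E₁]
    [NormedAddCommGroup E₂] [NormedAddCommGroup E₃] {f : E₁ → E₂ → E₃} {β : ℝ}
    (h : ∀ u u' s s', ‖f u s - f u' s'‖ ≤ β * √(‖u - u'‖ ^ 2 + ‖s - s'‖ ^ 2)) :
    Continuous fun p : E₁ × E₂ => f p.1 p.2 := by
  rw [continuous_iff_continuousAt]
  intro p
  rw [ContinuousAt, tendsto_iff_norm_sub_tendsto_zero]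
  have hc : Continuous fun q : E₁ × E₂ => β * √(‖q.1 - p.1‖ ^ 2 + ‖q.2 - p.2‖ ^ 2) := by fun_prop
  have h0 := hc.tendsto p
  simp only [sub_self, norm_zero, ne_eq, OfNat.ofNat_ne_zero, not_false_eq_true, zero_pow,
    add_zero, Real.sqrt_zero, mul_zero] at h0
  exact squeeze_zero (fun _ => norm_nonneg _) (fun q => h _ _ _ _) h0

/-- Only partial gradients are assumed to exist; their joint continuity, from the Lipschitz bounds,
upgrades them to the joint derivative that the chain rule needs. -/
theorem hasStrictFDerivAt_J (hs : G.SmoothCosts) (hlip : G.LipschitzCosts β₁ β₂ β₃) (i : Fin N)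
    (p : Vec (n i) × Vec d) :
    HasStrictFDerivAt (fun q : Vec (n i) × Vec d => G.J i q.1 q.2)
      ((innerSL ℝ (G.grad₁ i p.1 p.2)).coprod (innerSL ℝ (G.grad₂ i p.1 p.2))) p := by
  have h := hasStrictFDerivAt_uncurry_coprod (𝕜 := ℝ) (u := p) (f := G.J i)
    (f₁ := fun u s => innerSL ℝ (G.grad₁ i u s)) (f₂ := fun u s => innerSL ℝ (G.grad₂ i u s))
    (Filter.Eventually.of_forall fun q => (hs.diff_fst i q.2 q.1).hasGradientAt.hasFDerivAt)
    (Filter.Eventually.of_forall fun q => (hs.diff_snd i q.1 q.2).hasGradientAt.hasFDerivAt)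
    ((innerSL ℝ).continuous.comp (continuous_of_norm_sub_le (hlip.grad₁_le i))).continuousAt
    ((innerSL ℝ).continuous.comp (continuous_of_norm_sub_le (hlip.grad₂_le i))).continuousAt
  exact h

/-- Chain rule: the total own gradient in terms of the partial gradients. -/
theorem ownGrad_eq_Ftilde (hs : G.SmoothCosts) (hlip : G.LipschitzCosts β₁ β₂ β₃) (i : Fin N)
    (u : Vec (n i)) (s : Vec d) :
    G.ownGrad i u s = G.Ftilde i u ((1 / (N : ℝ)) • G.φ i u + s) := by
  have h1 := (hasStrictFDerivAt_J hs hlip i (u, (1 / (N : ℝ)) • G.φ i u + s)).hasFDerivAt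
  have h2 : HasFDerivAt (fun v => (v, (1 / (N : ℝ)) • G.φ i v + s))
      ((ContinuousLinearMap.id ℝ (Vec (n i))).prod ((1 / (N : ℝ)) • fderiv ℝ (G.φ i) u)) u :=
    (hasFDerivAt_id u).prodMk (((hs.diff_φ i u).hasFDerivAt.fun_const_smul _).add_const _)
  have h3 := h1.comp u h2
  have h4 : InnerProductSpace.toDual ℝ (Vec (n i)) (G.Ftilde i u ((1 / (N : ℝ)) • G.φ i u + s)) =
      ((innerSL ℝ (G.grad₁ i u ((1 / (N : ℝ)) • G.φ i u + s))).coprod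
        (innerSL ℝ (G.grad₂ i u ((1 / (N : ℝ)) • G.φ i u + s)))).comp
      ((ContinuousLinearMap.id ℝ (Vec (n i))).prod ((1 / (N : ℝ)) • fderiv ℝ (G.φ i) u)) := by
    ext1 v
    simp [Ftilde, ContinuousLinearMap.adjoint_inner_left]
  refine HasGradientAt.gradient ?_
  rw [hasGradientAt_iff_hasFDerivAt, h4]
  exact h3

/-- Shifting the second argument lets `Ftilde` inherit the Lipschitz bound of `ownGrad` without
estimating the product `∇φ_i ∇₂J_i`. -/
theorem Ftilde_eq_ownGrad (hs : G.SmoothCosts) (hlip : G.LipschitzCosts β₁ β₂ β₃) (i : Fin N)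
    (u : Vec (n i)) (s : Vec d) :
    G.Ftilde i u s = G.ownGrad i u (s - (1 / (N : ℝ)) • G.φ i u) := by
  rw [ownGrad_eq_Ftilde hs hlip, add_sub_cancel]

theorem norm_ownGrad_sub_le (hlip : G.LipschitzCosts β₁ β₂ β₃) (i : Fin N)
    (u u' : Vec (n i)) (s s' : Vec d) :
    ‖G.ownGrad i u s - G.ownGrad i u' s'‖ ≤ |β₁| * (‖u - u'‖ + ‖s - s'‖) := by
  refine (hlip.ownGrad_le i u u' s s').trans ?_
  refine mul_le_mul (le_abs_self _) ?_ (Real.sqrt_nonneg _) (abs_nonneg _)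
  rw [Real.sqrt_le_left (by positivity)]
  nlinarith [mul_nonneg (norm_nonneg (u - u')) (norm_nonneg (s - s'))]

theorem norm_Ftilde_sub_le (hs : G.SmoothCosts) (hlip : G.LipschitzCosts β₁ β₂ β₃) (i : Fin N)
    (u : Vec (n i)) (s s' : Vec d) : ‖G.Ftilde i u s - G.Ftilde i u s'‖ ≤ |β₁| * ‖s - s'‖ := by
  rw [Ftilde_eq_ownGrad hs hlip, Ftilde_eq_ownGrad hs hlip]
  simpa using norm_ownGrad_sub_le hlip i u u (s - (1 / (N : ℝ)) • G.φ i u)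
    (s' - (1 / (N : ℝ)) • G.φ i u)

theorem norm_φ_sub_le (hlip : G.LipschitzCosts β₁ β₂ β₃) (x y : Profile n) (i : Fin N) :
    ‖G.φ i (x i) - G.φ i (y i)‖ ≤ |β₃| * ‖x - y‖ := by
  refine (hlip.φ_le i _ _).trans ?_
  gcongr
  · exact le_abs_self _
  · exact PiLp.norm_apply_le (x - y) i

theorem mean_φ_eq (x : Profile n) (i : Fin N) :
    mean (fun j => G.φ j (x j)) = (1 / (N : ℝ)) • G.φ i (x i) + G.sigmaOthers i x := by
  rw [mean, sigmaOthers, ← smul_add, Finset.add_sum_erase _ (fun j => G.φ j (x j))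
    (Finset.mem_univ i)]

theorem F_apply_eq_Ftilde (hs : G.SmoothCosts) (hlip : G.LipschitzCosts β₁ β₂ β₃)
    (x : Profile n) (i : Fin N) :
    G.F x i = G.Ftilde i (x i) (mean (fun j => G.φ j (x j))) := by
  rw [mean_φ_eq x i, ← ownGrad_eq_Ftilde hs hlip]
  rfl

theorem norm_sigmaOthers_sub_le (hN : 0 < N) (hlip : G.LipschitzCosts β₁ β₂ β₃) (i : Fin N)
    (x y : Profile n) :
    ‖G.sigmaOthers i x - G.sigmaOthers i y‖ ≤ |β₃| * ‖x - y‖ := by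
  have hN' : (0 : ℝ) < N := by positivity
  rw [sigmaOthers, sigmaOthers, ← smul_sub, ← Finset.sum_sub_distrib, norm_smul,
    Real.norm_of_nonneg (by positivity)]
  calc _ ≤ 1 / (N : ℝ) * (N * (|β₃| * ‖x - y‖)) := by
        gcongr
        refine (norm_sum_le _ _).trans ((Finset.sum_le_sum
          fun j _ => norm_φ_sub_le hlip x y j).trans ?_)
        rw [Finset.sum_const, nsmul_eq_mul]
        gcongr
        simp
    _ = _ := by field_simp

theorem norm_F_sub_le (hN : 0 < N) (hlip : G.LipschitzCosts β₁ β₂ β₃) (x y : Profile n) :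
    ‖G.F x - G.F y‖ ≤ N * (|β₁| * (1 + |β₃|)) * ‖x - y‖ := by
  have h : ∀ i, ‖(G.F x - G.F y) i‖ ≤ |β₁| * (1 + |β₃|) * ‖x - y‖ := by
    intro i
    refine (norm_ownGrad_sub_le hlip i (x i) (y i) _ _).trans ?_
    rw [mul_assoc, add_mul, one_mul]
    gcongr
    · exact PiLp.norm_apply_le (x - y) i
    · exact norm_sigmaOthers_sub_le hN hlip i x y
  have := norm_toLp_le_of_le (fun i => (G.F x - G.F y) i) h (by positivity)
  rw [Fintype.card_fin] at this
  rw [mul_assoc]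
  exact this

/-! ### Variational equilibria -/

theorem sigmaOthers_update (i : Fin N) (x : Profile n) (u : Vec (n i)) :
    G.sigmaOthers i (WithLp.toLp 2 (Function.update x.ofLp i u)) = G.sigmaOthers i x := by
  rw [sigmaOthers, sigmaOthers]
  congr 1
  refine Finset.sum_congr rfl fun j hj => ?_
  rw [PiLp.toLp_apply, Function.update_of_ne (Finset.ne_of_mem_erase hj)]

theorem inner_update_sub_update (i : Fin N) (f x : Profile n) (u u' : Vec (n i)) :
    inner ℝ f (WithLp.toLp 2 (Function.update x.ofLp i u)
      - WithLp.toLp 2 (Function.update x.ofLp i u')) = inner ℝ (f i) (u - u') := by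
  rw [PiLp.inner_apply, Finset.sum_eq_single i]
  · simp
  · intro j _ hj
    simp [hj]
  · simp

/-- Monotonicity is tested on two profiles differing only in block `i`, where `σ_{-i}` is the same.
-/
theorem StronglyMonotone.inner_ownGrad_nonneg {μ : ℝ} (hμ : 0 ≤ μ) (hmono : G.StronglyMonotone μ)
    (i : Fin N) (x : Profile n) (u u' : Vec (n i)) :
    0 ≤ inner ℝ (G.ownGrad i u (G.sigmaOthers i x) - G.ownGrad i u' (G.sigmaOthers i x))
      (u - u') := by
  have h := hmono (WithLp.toLp 2 (Function.update x.ofLp i u))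
    (WithLp.toLp 2 (Function.update x.ofLp i u'))
  rw [inner_update_sub_update] at h
  have h' : ∀ v, G.F (WithLp.toLp 2 (Function.update x.ofLp i v)) i
      = G.ownGrad i v (G.sigmaOthers i x) := by
    intro v
    simp only [F, sigmaOthers_update, PiLp.toLp_apply, Function.update_self]
  rw [PiLp.sub_apply, h', h'] at h
  exact le_trans (by positivity) h

/-- Along the segment from `u₀` to `u` the derivative is at least its value at `u₀`, hence
nonnegative. -/
theorem ownCost_le_of_inner_nonneg {μ : ℝ} (hs : G.SmoothCosts) (hμ : 0 ≤ μ)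
    (hmono : G.StronglyMonotone μ) (i : Fin N) (x : Profile n) (u₀ u : Vec (n i))
    (h : 0 ≤ inner ℝ (G.ownGrad i u₀ (G.sigmaOthers i x)) (u - u₀)) :
    G.ownCost i (G.sigmaOthers i x) u₀ ≤ G.ownCost i (G.sigmaOthers i x) u := by
  set s := G.sigmaOthers i x
  have hd : ∀ t : ℝ, HasDerivAt (fun t : ℝ => G.ownCost i s (u₀ + t • (u - u₀)))
      (inner ℝ (G.ownGrad i (u₀ + t • (u - u₀)) s) (u - u₀)) t := by
    intro t
    have h1 := ((hs.contDiff_ownCost i x).differentiable one_ne_zero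
      (u₀ + t • (u - u₀))).hasGradientAt.hasFDerivAt
    have h2 : HasDerivAt (fun t : ℝ => u₀ + t • (u - u₀)) (u - u₀) t := by
      simpa using ((hasDerivAt_id t).smul_const (u - u₀)).const_add u₀
    exact h1.comp_hasDerivAt t h2
  have hmon := monotoneOn_of_deriv_nonneg (convex_Icc (0 : ℝ) 1)
    (fun t _ => (hd t).continuousAt.continuousWithinAt)
    (fun t _ => (hd t).differentiableAt.differentiableWithinAt) (by
      intro t ht
      rw [interior_Icc] at ht
      rw [(hd t).deriv]
      have h1 := hmono.inner_ownGrad_nonneg hμ i x (u₀ + t • (u - u₀)) u₀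
      rw [add_sub_cancel_left, real_inner_smul_right, inner_sub_left] at h1
      have h2 := nonneg_of_mul_nonneg_right h1 ht.1
      linarith)
  have := hmon (Set.left_mem_Icc.mpr zero_le_one) (Set.right_mem_Icc.mpr zero_le_one) zero_le_one
  simpa using this

/-- A feasible unilateral deviation is a feasible profile, and against it the variational inequality
reduces to agent `i`'s first-order condition. -/
theorem IsVariationalGNE.isGNE {μ : ℝ} (hs : G.SmoothCosts) (hμ : 0 ≤ μ)
    (hmono : G.StronglyMonotone μ) {x : Profile n} (hx : G.IsVariationalGNE x) : G.IsGNE x := by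
  refine ⟨hx.1, fun i u hu => ownCost_le_of_inner_nonneg hs hμ hmono i x (x i) u ?_⟩
  have hfeas : WithLp.toLp 2 (Function.update x.ofLp i u) ∈ G.feasibleSet := by
    intro l
    have hsum : ∑ j, G.c j (Function.update x.ofLp i u j)
        = G.c i u + ∑ j ∈ Finset.univ.erase i, G.c j (x j) := by
      rw [← Finset.add_sum_erase _ _ (Finset.mem_univ i), Function.update_self]
      congr 1
      refine Finset.sum_congr rfl fun j hj => ?_
      rw [Function.update_of_ne (Finset.ne_of_mem_erase hj)]
    simp only [hsum]
    exact hu l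
  have h := hx.2 _ hfeas
  have h' := inner_update_sub_update i (G.F x) x u (x i)
  rw [Function.update_eq_self, WithLp.toLp_ofLp] at h'
  rw [h'] at h
  exact h

theorem IsVariationalGNE.unique {μ : ℝ} (hμ : 0 < μ) (hmono : G.StronglyMonotone μ)
    {x y : Profile n} (hx : G.IsVariationalGNE x) (hy : G.IsVariationalGNE y) : x = y := by
  have h1 := hx.2 y hy.1
  have h2 := hy.2 x hx.1
  have h3 := hmono x y
  have h4 : inner ℝ (G.F x) (y - x) = -inner ℝ (G.F x) (x - y) := by
    rw [← inner_neg_right, neg_sub]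
  rw [inner_sub_left] at h3
  have h5 : ‖x - y‖ ^ 2 ≤ 0 := by
    by_contra hpos
    push Not at hpos
    have : 0 < μ * ‖x - y‖ ^ 2 := by positivity
    linarith
  have h6 : ‖x - y‖ = 0 := by nlinarith [norm_nonneg (x - y)]
  exact sub_eq_zero.mp (norm_eq_zero.mp h6)

/-- Karush-Kuhn-Tucker points, written as zeros of the augmented primal-dual operator, are
variational equilibria. -/
theorem isVariationalGNE_of_kkt {ρ : ℝ} (hρ : 0 < ρ) {x : Profile n} {y : Vec m}
    (h₁ : G.F x + G.couplingMapT y = 0)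
    (h₂ : nonnegPart (ρ • (G.couplingMap x - ∑ i, G.b i) + y) = y) : G.IsVariationalGNE x := by
  set r := G.couplingMap x - ∑ i, G.b i with hr
  -- Each scalar equation encodes dual feasibility, primal feasibility and complementarity at once.
  have hl : ∀ l, max (ρ * r l + y l) 0 = y l := by
    intro l
    have := congrArg (fun v : Vec m => v l) h₂
    simpa [nonnegPart] using this
  have hy : ∀ l, 0 ≤ y l := fun l => by rw [← hl l]; exact le_max_right _ _
  have hrl : ∀ l, r l ≤ 0 := by
    intro l
    have h : ρ * r l + y l ≤ y l := by
      conv_rhs => rw [← hl l]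
      exact le_max_left _ _
    by_contra hpos
    push Not at hpos
    have := mul_pos hρ hpos
    linarith
  have hcomp : ∀ l, y l * r l = 0 := by
    intro l
    rcases max_cases (ρ * r l + y l) 0 with h | h
    · have h' : ρ * r l = 0 := by linarith [hl l, h.1]
      rw [(mul_eq_zero.mp h').resolve_left hρ.ne', mul_zero]
    · rw [← hl l, h.1, zero_mul]
  refine ⟨fun l => by rw [sum_c]; exact hrl l, fun z hz => ?_⟩
  rw [eq_neg_of_add_eq_zero_left h₁, inner_neg_left, inner_couplingMapT, Left.nonneg_neg_iff]
  have hz' : G.couplingMap (z - x) = (G.couplingMap z - ∑ i, G.b i) - r := by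
    rw [map_sub, hr]
    abel
  rw [hz', PiLp.inner_apply]
  refine Finset.sum_nonpos fun l _ => ?_
  have hzl := hz l
  rw [sum_c] at hzl
  simp only [PiLp.sub_apply (x := G.couplingMap z - ∑ i, G.b i), RCLike.inner_apply,
    conj_trivial, sub_mul]
  rw [mul_comm (r l), hcomp l, sub_zero]
  exact mul_nonpos_of_nonpos_of_nonneg hzl (hy l)

variable (G)

/-! ### The distributed algorithm in tracking coordinates -/

/-- Agent `i`'s estimate `φ_i(x_i) + z_i` of the aggregate. -/
def aggEstimate (S : State N d m n) (i : Fin N) : Vec d := G.φ i (S.x i) + S.z i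

/-- Agent `i`'s estimate `N c_i(x_i) + y_i` of the constraint violation `A x - b`. -/
noncomputable def conEstimate (S : State N d m n) (i : Fin N) : Vec m :=
  (N : ℝ) • G.c i (S.x i) + S.y i

/-- Total disagreement of the multipliers and of the two trackers. -/
noncomputable def disagreement (S : State N d m n) : ℝ :=
  ‖deviation S.lam‖ + ‖deviation (G.aggEstimate S)‖ + ‖deviation (G.conEstimate S)‖

variable {G} {w : Matrix (Fin N) (Fin N) ℝ} {ρ δ : ℝ} {S : State N d m n}

theorem disagreement_nonneg : 0 ≤ G.disagreement S := by
  unfold disagreement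
  positivity

theorem norm_lam_sub_mean_le (i : Fin N) : ‖S.lam i - mean S.lam‖ ≤ G.disagreement S := by
  have h := norm_sub_mean_le S.lam i
  have h1 := norm_nonneg (deviation (G.aggEstimate S))
  have h2 := norm_nonneg (deviation (G.conEstimate S))
  unfold disagreement
  linarith

theorem norm_aggEstimate_sub_mean_le (i : Fin N) :
    ‖G.aggEstimate S i - mean (G.aggEstimate S)‖ ≤ G.disagreement S := by
  have h := norm_sub_mean_le (G.aggEstimate S) i
  have h1 := norm_nonneg (deviation S.lam)
  have h2 := norm_nonneg (deviation (G.conEstimate S))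
  unfold disagreement
  linarith

theorem norm_conEstimate_sub_mean_le (i : Fin N) :
    ‖G.conEstimate S i - mean (G.conEstimate S)‖ ≤ G.disagreement S := by
  have h := norm_sub_mean_le (G.conEstimate S) i
  have h1 := norm_nonneg (deviation S.lam)
  have h2 := norm_nonneg (deviation (G.aggEstimate S))
  unfold disagreement
  linarith

theorem mean_aggEstimate (hz : ∑ i, S.z i = 0) :
    mean (G.aggEstimate S) = mean (fun i => G.φ i (S.x i)) := by
  simp only [mean, aggEstimate, Finset.sum_add_distrib, hz, add_zero]

theorem mean_conEstimate (hN : 0 < N) (hy : ∑ i, S.y i = 0) :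
    mean (G.conEstimate S) = G.couplingMap S.x - ∑ i, G.b i := by
  have : (N : ℝ) ≠ 0 := by positivity
  rw [← sum_c]
  simp only [mean, conEstimate, Finset.sum_add_distrib, hy, add_zero, ← Finset.smul_sum]
  rw [smul_smul, one_div, inv_mul_cancel₀ this, one_smul]

/-- In these coordinates tracking is average consensus driven by the increments of `φ_i(x_i)`, which
are as small as the step in `x`. -/
theorem aggEstimate_step (i : Fin N) :
    G.aggEstimate (G.step w ρ δ S) i = ∑ j, w i j • G.aggEstimate S j
      + (G.φ i ((G.step w ρ δ S).x i) - G.φ i (S.x i)) := by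
  have : (G.step w ρ δ S).z i
      = ∑ j, w i j • S.z j + ∑ j, w i j • G.φ j (S.x j) - G.φ i (S.x i) := rfl
  simp only [aggEstimate, this, smul_add, Finset.sum_add_distrib]
  abel

theorem conEstimate_step (i : Fin N) :
    G.conEstimate (G.step w ρ δ S) i = ∑ j, w i j • G.conEstimate S j
      + (N : ℝ) • (G.c i ((G.step w ρ δ S).x i) - G.c i (S.x i)) := by
  have : (G.step w ρ δ S).y i = ∑ j, w i j • S.y j
      + ∑ j, w i j • ((N : ℝ) • G.c j (S.x j)) - (N : ℝ) • G.c i (S.x i) := rfl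
  simp only [conEstimate, this, smul_add, smul_sub, Finset.sum_add_distrib]
  abel

theorem sum_z_step (hw : w ∈ doublyStochastic ℝ (Fin N)) (hz : ∑ i, S.z i = 0) :
    ∑ i, (G.step w ρ δ S).z i = 0 := by
  simp only [step, Finset.sum_sub_distrib, Finset.sum_add_distrib]
  rw [sum_sum_smul_of_doublyStochastic hw,
    sum_sum_smul_of_doublyStochastic hw (fun j => G.φ j (S.x j)), hz]
  simp

theorem sum_y_step (hw : w ∈ doublyStochastic ℝ (Fin N)) (hy : ∑ i, S.y i = 0) :
    ∑ i, (G.step w ρ δ S).y i = 0 := by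
  simp only [step, Finset.sum_sub_distrib, Finset.sum_add_distrib]
  rw [sum_sum_smul_of_doublyStochastic hw,
    sum_sum_smul_of_doublyStochastic hw (fun j => (N : ℝ) • G.c j (S.x j)), hy]
  simp

/-- Changing only block `i` of `x'` exhibits `A_i` as a restriction of `couplingMap`, so its norm
serves for every agent. -/
theorem norm_c_sub_le (x x' : Profile n) (i : Fin N) :
    ‖G.c i (x i) - G.c i (x' i)‖ ≤ ‖G.couplingMap‖ * ‖x - x'‖ := by
  have hsum : ∀ u, ∑ j, G.c j (Function.update x'.ofLp i u j)
      = G.c i u + ∑ j ∈ Finset.univ.erase i, G.c j (x' j) := by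
    intro u
    rw [← Finset.add_sum_erase _ _ (Finset.mem_univ i), Function.update_self]
    congr 1
    refine Finset.sum_congr rfl fun j hj => ?_
    rw [Function.update_of_ne (Finset.ne_of_mem_erase hj)]
  set v : Profile n := WithLp.toLp 2 (Function.update x'.ofLp i (x i)) with hv
  have h1 : G.c i (x i) - G.c i (x' i) = G.couplingMap (v - x') := by
    have e1 := G.sum_c v
    have e2 := G.sum_c x'
    simp only [hv] at e1
    rw [hsum] at e1
    rw [← Finset.add_sum_erase _ _ (Finset.mem_univ i)] at e2
    rw [map_sub]
    calc _ = (G.c i (x i) + ∑ j ∈ Finset.univ.erase i, G.c j (x' j))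
          - (G.c i (x' i) + ∑ j ∈ Finset.univ.erase i, G.c j (x' j)) := by abel
      _ = _ := by rw [e1, e2]; abel
  have h2 : ‖v - x'‖ ≤ ‖x - x'‖ := by
    rw [PiLp.norm_eq_of_L2, PiLp.norm_eq_of_L2]
    apply Real.sqrt_le_sqrt
    refine Finset.sum_le_sum fun j _ => ?_
    rcases eq_or_ne j i with rfl | hj
    · simp [hv]
    · simp [hv, hj]
  rw [h1]
  exact (G.couplingMap.le_opNorm _).trans (by gcongr)

/-! ### One-step estimates for the mean error and the disagreement -/

/-- The averaged primal-dual error follows a perturbed Euler step of the augmented primal-dual flow,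
with perturbations bounded by the disagreement. -/
theorem exists_perturbed_step {β₁ β₂ β₃ : ℝ} (hN : 0 < N) (hs : G.SmoothCosts)
    (hlip : G.LipschitzCosts β₁ β₂ β₃) (hw : w ∈ doublyStochastic ℝ (Fin N)) (hρ : 0 < ρ)
    {xs : Profile n} {ys : Vec m} (h₁ : G.F xs + G.couplingMapT ys = 0)
    (hz : ∑ i, S.z i = 0) (δ : ℝ) :
    ∃ (e : Profile n) (h : Vec m),
      (G.step w ρ δ S).x - xs = (S.x - xs) - δ • (G.F S.x - G.F xs
        + G.couplingMapT (nonnegPart (ρ • mean (G.conEstimate S) + mean S.lam) - ys) + e) ∧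
      mean (G.step w ρ δ S).lam - ys = (mean S.lam - ys) - δ • (ρ⁻¹ • ((mean S.lam - ys)
        - (nonnegPart (ρ • mean (G.conEstimate S) + mean S.lam) - ys)) + h) ∧
      ‖e‖ + ‖h‖ ≤ (N * (|β₁| + ‖G.couplingMapT‖ * (ρ + 1)) + ρ⁻¹ * (ρ + 1))
        * G.disagreement S := by
  set D := G.disagreement S with hD
  have hD0 : 0 ≤ D := disagreement_nonneg
  set P₀ := nonnegPart (ρ • mean (G.conEstimate S) + mean S.lam) with hP₀
  set P : Fin N → Vec m := fun i => nonnegPart (ρ • G.conEstimate S i + S.lam i) with hP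
  have hPP : ∀ i, ‖P i - P₀‖ ≤ (ρ + 1) * D := by
    intro i
    refine (norm_nonnegPart_sub_le _ _).trans ?_
    have : ρ • G.conEstimate S i + S.lam i - (ρ • mean (G.conEstimate S) + mean S.lam)
        = ρ • (G.conEstimate S i - mean (G.conEstimate S)) + (S.lam i - mean S.lam) := by
      rw [smul_sub]; abel
    rw [this, add_mul, one_mul]
    refine (norm_add_le _ _).trans ?_
    rw [norm_smul, Real.norm_of_nonneg hρ.le]
    gcongr
    · exact norm_conEstimate_sub_mean_le i
    · exact norm_lam_sub_mean_le i
  let e : Profile n := WithLp.toLp 2 (fun i =>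
    (G.Ftilde i (S.x i) (G.aggEstimate S i) - G.Ftilde i (S.x i) (mean (G.aggEstimate S)))
      + G.couplingMapT (P i - P₀) i)
  have he : ∀ i, ‖(G.Ftilde i (S.x i) (G.aggEstimate S i)
      - G.Ftilde i (S.x i) (mean (G.aggEstimate S))) + G.couplingMapT (P i - P₀) i‖
      ≤ (|β₁| + ‖G.couplingMapT‖ * (ρ + 1)) * D := by
    intro i
    refine (norm_add_le _ _).trans ?_
    rw [add_mul, mul_assoc]
    gcongr
    · refine (norm_Ftilde_sub_le hs hlip i _ _ _).trans ?_
      gcongr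
      exact norm_aggEstimate_sub_mean_le i
    · refine (PiLp.norm_apply_le _ i).trans ((G.couplingMapT.le_opNorm _).trans ?_)
      gcongr
      exact hPP i
  have hhb : ‖mean (fun i => P₀ - P i)‖ ≤ (ρ + 1) * D :=
    norm_mean_le hN fun i => by rw [norm_sub_rev]; exact hPP i
  -- `e` gathers the errors from the local aggregate estimates and local projections; the dual error
  -- arises because the mean of the projections differs from the projection `P₀` of the mean.
  refine ⟨e, ρ⁻¹ • mean (fun i => P₀ - P i), ?_, ?_, ?_⟩
  · ext1 i
    have hF : G.F S.x i = G.Ftilde i (S.x i) (mean (G.aggEstimate S)) := by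
      rw [mean_aggEstimate hz, F_apply_eq_Ftilde hs hlip]
    have hx : (G.step w ρ δ S).x i = S.x i - δ • G.Ftilde i (S.x i) (G.aggEstimate S i)
        - δ • G.couplingMapT (P i) i := rfl
    have h0 : G.F xs i = -G.couplingMapT ys i := by
      have := congrArg (fun v : Profile n => v i) h₁
      exact eq_neg_of_add_eq_zero_left this
    simp only [PiLp.sub_apply, PiLp.add_apply, PiLp.smul_apply, map_sub, hx, hF, h0, e]
    module
  · have hlam : (G.step w ρ δ S).lam
        = fun i => ∑ j, w i j • S.lam j + δ • (ρ⁻¹ • (P i - S.lam i)) := by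
      funext i
      have : (G.step w ρ δ S).lam i = ∑ j, w i j • S.lam j
        + δ • Glam ρ (G.conEstimate S i) (S.lam i) := rfl
      rw [this, Glam_eq]
    have hm1 : mean (fun i => ∑ j, w i j • S.lam j) = mean S.lam := by
      rw [mean, sum_sum_smul_of_doublyStochastic hw, mean]
    have hm2 : mean (fun i => P₀ - P i) = P₀ - mean P := by
      conv_rhs => rw [← mean_const hN P₀]
      simp only [mean, Finset.sum_sub_distrib, smul_sub]
    have hm3 : mean (fun i => δ • (ρ⁻¹ • (P i - S.lam i)))
        = δ • (ρ⁻¹ • (mean P - mean S.lam)) := by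
      simp only [mean, ← Finset.smul_sum, Finset.sum_sub_distrib, ← smul_sub]
      module
    rw [hlam, mean_add, hm1, hm2, hm3]
    module
  · have h1 := norm_toLp_le_of_le _ he (by positivity)
    rw [Fintype.card_fin] at h1
    rw [norm_smul, Real.norm_of_nonneg (by positivity), add_mul, mul_assoc, mul_assoc]
    gcongr

/-- Contraction estimates, up to terms of order `δ`, for the disagreement. -/
theorem disagreement_step_le {E : Digraph (Fin N)} {β₁ β₂ β₃ σ D M : ℝ} (hN : 0 < N)
    (hlip : G.LipschitzCosts β₁ β₂ β₃) (hnet : IsNetwork E w)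
    (hσ : ∀ (k : ℕ) (v : Fin N → Vec k), ∑ i, v i = 0 →
      ‖(WithLp.toLp 2 (fun i => ∑ j, w i j • v j) : PiLp 2 (fun _ : Fin N => Vec k))‖ ≤
        σ * ‖(WithLp.toLp 2 v : PiLp 2 (fun _ : Fin N => Vec k))‖)
    (hδ : 0 ≤ δ) (hD : 0 ≤ D) (hM : ∀ i, ‖Glam ρ (G.conEstimate S i) (S.lam i)‖ ≤ M)
    (hM0 : 0 ≤ M) (hx : ‖(G.step w ρ δ S).x - S.x‖ ≤ δ * D) :
    G.disagreement (G.step w ρ δ S) ≤ σ * G.disagreement S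
      + δ * (N * (M + (|β₃| + N * ‖G.couplingMap‖) * D)) := by
  have h1 : ‖deviation (G.step w ρ δ S).lam‖ ≤ σ * ‖deviation S.lam‖ + N * (δ * M) := by
    refine hnet.norm_deviation_step_le hN (hσ m) S.lam
      (fun i => δ • Glam ρ (G.conEstimate S i) (S.lam i)) (fun i => ?_) (by positivity)
    rw [norm_smul, Real.norm_of_nonneg hδ]
    gcongr
    exact hM i
  have h2 : ‖deviation (G.aggEstimate (G.step w ρ δ S))‖
      ≤ σ * ‖deviation (G.aggEstimate S)‖ + N * (|β₃| * (δ * D)) := by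
    have := hnet.norm_deviation_step_le hN (hσ d) (G.aggEstimate S)
      (fun i => G.φ i ((G.step w ρ δ S).x i) - G.φ i (S.x i)) (C := |β₃| * (δ * D))
      (fun i => (norm_φ_sub_le hlip _ _ i).trans (by gcongr)) (by positivity)
    simpa only [← aggEstimate_step] using this
  have h3 : ‖deviation (G.conEstimate (G.step w ρ δ S))‖
      ≤ σ * ‖deviation (G.conEstimate S)‖ + N * (N * (‖G.couplingMap‖ * (δ * D))) := by
    have := hnet.norm_deviation_step_le hN (hσ m) (G.conEstimate S)
      (fun i => (N : ℝ) • (G.c i ((G.step w ρ δ S).x i) - G.c i (S.x i)))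
      (C := N * (‖G.couplingMap‖ * (δ * D)))
      (fun i => by
        rw [norm_smul, Real.norm_of_nonneg (by positivity)]
        gcongr
        exact (norm_c_sub_le _ _ i).trans (by gcongr)) (by positivity)
    simpa only [← conEstimate_step] using this
  unfold disagreement
  linear_combination h1 + h2 + h3

/-- Norm of the averaged primal-dual error. -/
noncomputable def primalDualError (xs : Profile n) (ys : Vec m) (S : State N d m n) : ℝ :=
  ‖S.x - xs‖ + ‖mean S.lam - ys‖

/-- Supplies the two hypotheses of `exists_two_timescale_rate`, with the mean error as `a`, the
disagreement as `b`, and constants independent of `δ` and of the state. -/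
theorem exists_step_estimates {E : Digraph (Fin N)} {μ β₁ β₂ β₃ κ₁ : ℝ} (hN : 0 < N)
    (hs : G.SmoothCosts) (hμ : 0 < μ) (hmono : G.StronglyMonotone μ)
    (hlip : G.LipschitzCosts β₁ β₂ β₃) (hnet : IsNetwork E w) (hκ₁ : 0 < κ₁)
    (hA : ∀ y, κ₁ * ‖y‖ ^ 2 ≤ ‖G.couplingMapT y‖ ^ 2) (hρ : 0 < ρ)
    {xs : Profile n} {ys : Vec m} (h₁ : G.F xs + G.couplingMapT ys = 0)
    (h₂ : nonnegPart (ρ • (G.couplingMap xs - ∑ i, G.b i) + ys) = ys) :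
    ∃ α c σ L : ℝ, ‖G.couplingMap‖ + 1 ≤ α ∧ 0 < c ∧ 0 ≤ σ ∧ σ < 1 ∧ 0 ≤ L ∧
      ∀ (δ : ℝ) (S : State N d m n), 0 < δ → ∑ i, S.z i = 0 → ∑ i, S.y i = 0 →
        primalDualForm G.couplingMap α ((G.step w ρ δ S).x - xs)
            (mean (G.step w ρ δ S).lam - ys) ≤
          primalDualForm G.couplingMap α (S.x - xs) (mean S.lam - ys)
            - c * δ * primalDualError xs ys S ^ 2
            + δ * L * primalDualError xs ys S * G.disagreement S
            + δ ^ 2 * L * (primalDualError xs ys S + G.disagreement S) ^ 2 ∧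
        G.disagreement (G.step w ρ δ S) ≤ σ * G.disagreement S
          + δ * L * (primalDualError xs ys S + G.disagreement S) := by
  obtain ⟨α, hα, c, hc, K, hK, H⟩ := exists_primalDual_step (L := N * (|β₁| * (1 + |β₃|)))
    G.inner_couplingMapT hκ₁ hA hμ hρ (by positivity)
  obtain ⟨σ, hσ0, hσ1, hσ⟩ := hnet.exists_contraction
  set K₁ : ℝ := N * (|β₁| + ‖G.couplingMapT‖ * (ρ + 1)) + ρ⁻¹ * (ρ + 1) with hK₁
  set K₂ : ℝ := ρ⁻¹ * (ρ * ‖G.couplingMap‖ + ρ + 3) with hK₂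
  have hK₁0 : 0 ≤ K₁ := by positivity
  have hK₂0 : 0 ≤ K₂ := by positivity
  set L₁ : ℝ := K * (1 + K₁) ^ 2
  set L₂ : ℝ := N * (K₂ + (|β₃| + N * ‖G.couplingMap‖) * (K * (1 + K₁)))
  have hL₁ : 0 ≤ L₁ := by positivity
  have hL₂ : 0 ≤ L₂ := by positivity
  refine ⟨α, c, σ, L₁ + L₂, hα, hc, hσ0, hσ1, by positivity, fun δ S hδ hz hy => ?_⟩
  obtain ⟨e, h, hxs, hls, heh⟩ :=
    exists_perturbed_step hN hs hlip hnet.doubly_stochastic hρ h₁ hz δ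
  set D := G.disagreement S with hD
  set a := primalDualError xs ys S with ha
  have hD0 : 0 ≤ D := disagreement_nonneg
  have ha0 : 0 ≤ a := by rw [ha, primalDualError]; positivity
  set P₀ := nonnegPart (ρ • mean (G.conEstimate S) + mean S.lam) with hP₀
  have hdiff : ρ • G.couplingMap (S.x - xs) + (mean S.lam - ys)
      = (ρ • mean (G.conEstimate S) + mean S.lam)
        - (ρ • (G.couplingMap xs - ∑ i, G.b i) + ys) := by
    rw [mean_conEstimate hN hy, map_sub]
    module
  have hg : ‖P₀ - ys‖ ^ 2 ≤
      inner ℝ (P₀ - ys) (ρ • G.couplingMap (S.x - xs) + (mean S.lam - ys)) := by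
    have := nonnegPart_firm (ρ • mean (G.conEstimate S) + mean S.lam)
      (ρ • (G.couplingMap xs - ∑ i, G.b i) + ys)
    rwa [h₂, ← hdiff] at this
  have hgn : ‖P₀ - ys‖ ≤ (ρ * ‖G.couplingMap‖ + 1) * a := by
    have h3 := norm_nonnegPart_sub_le (ρ • mean (G.conEstimate S) + mean S.lam)
      (ρ • (G.couplingMap xs - ∑ i, G.b i) + ys)
    rw [h₂, ← hdiff] at h3
    refine h3.trans ((norm_add_le _ _).trans ?_)
    rw [norm_smul, Real.norm_of_nonneg hρ.le, add_mul, one_mul, mul_assoc]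
    have hxa : ‖S.x - xs‖ ≤ a := by
      rw [ha, primalDualError]; linarith [norm_nonneg (mean S.lam - ys)]
    have hla : ‖mean S.lam - ys‖ ≤ a := by
      rw [ha, primalDualError]; linarith [norm_nonneg (S.x - xs)]
    gcongr
    exact (G.couplingMap.le_opNorm _).trans (by gcongr)
  obtain ⟨hV, hmove⟩ := H δ (S.x - xs) (G.F S.x - G.F xs) e (mean S.lam - ys) (P₀ - ys) h hδ
    (hmono _ _) (norm_F_sub_le hN hlip _ _) hg
  rw [← hxs, ← hls] at hV
  change _ ≤ _ - c * δ * a ^ 2 + δ * K * a * (‖e‖ + ‖h‖) + δ ^ 2 * K * (a + (‖e‖ + ‖h‖)) ^ 2 at hV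
  change _ ≤ K * (a + (‖e‖ + ‖h‖)) at hmove
  have hsum : a + (‖e‖ + ‖h‖) ≤ (1 + K₁) * (a + D) := by
    have : 0 ≤ K₁ * a := by positivity
    linarith
  constructor
  · refine hV.trans ?_
    have t1 : δ * K * a * (‖e‖ + ‖h‖) ≤ δ * (L₁ + L₂) * a * D := by
      have hKK : K * K₁ ≤ L₁ + L₂ := by
        have : K * K₁ ≤ K * (1 + K₁) ^ 2 := by
          gcongr
          linear_combination hK₁0 + sq_nonneg K₁ + zero_le_one (α := ℝ)
        linarith
      calc _ ≤ δ * K * a * (K₁ * D) := by gcongr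
        _ = δ * (K * K₁) * a * D := by ring
        _ ≤ _ := by gcongr
    have t2 : δ ^ 2 * K * (a + (‖e‖ + ‖h‖)) ^ 2 ≤ δ ^ 2 * (L₁ + L₂) * (a + D) ^ 2 := by
      calc _ ≤ δ ^ 2 * K * ((1 + K₁) * (a + D)) ^ 2 := by gcongr
        _ = δ ^ 2 * L₁ * (a + D) ^ 2 := by simp only [L₁]; ring
        _ ≤ _ := by gcongr; linarith
    linarith
  · have hx : ‖(G.step w ρ δ S).x - S.x‖ ≤ δ * (K * (1 + K₁) * (a + D)) := by
      have : (G.step w ρ δ S).x - S.x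
          = -(δ • (G.F S.x - G.F xs + G.couplingMapT (P₀ - ys) + e)) := by
        have h3 : (G.step w ρ δ S).x - S.x = ((G.step w ρ δ S).x - xs) - (S.x - xs) := by abel
        rw [h3, hxs]
        abel
      rw [this, norm_neg, norm_smul, Real.norm_of_nonneg hδ.le]
      refine mul_le_mul_of_nonneg_left (hmove.trans ?_) hδ.le
      rw [mul_assoc]
      gcongr
    have hGlam : ∀ i, ‖Glam ρ (G.conEstimate S i) (S.lam i)‖ ≤ K₂ * (a + D) := by
      intro i
      rw [Glam_eq, norm_smul, Real.norm_of_nonneg (by positivity), hK₂, mul_assoc]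
      gcongr
      -- Inserting `P₀`, `ys` and `mean S.lam` leaves four differences, each bounded by `a` or by
      -- `D`; their total gives `K₂`.
      have hsplit : nonnegPart (ρ • G.conEstimate S i + S.lam i) - S.lam i
          = (nonnegPart (ρ • G.conEstimate S i + S.lam i) - P₀) + (P₀ - ys)
            - (S.lam i - mean S.lam) - (mean S.lam - ys) := by abel
      have hPi : ‖nonnegPart (ρ • G.conEstimate S i + S.lam i) - P₀‖ ≤ ρ * D + D := by
        refine (norm_nonnegPart_sub_le _ _).trans ?_
        have : ρ • G.conEstimate S i + S.lam i - (ρ • mean (G.conEstimate S) + mean S.lam)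
            = ρ • (G.conEstimate S i - mean (G.conEstimate S)) + (S.lam i - mean S.lam) := by
          rw [smul_sub]; abel
        rw [this]
        refine (norm_add_le _ _).trans ?_
        rw [norm_smul, Real.norm_of_nonneg hρ.le]
        gcongr
        · exact norm_conEstimate_sub_mean_le i
        · exact norm_lam_sub_mean_le i
      have hli : ‖S.lam i - mean S.lam‖ ≤ D := norm_lam_sub_mean_le i
      have hla : ‖mean S.lam - ys‖ ≤ a := by
        rw [ha, primalDualError]; linarith [norm_nonneg (S.x - xs)]
      rw [hsplit]
      have q1 := norm_sub_le ((nonnegPart (ρ • G.conEstimate S i + S.lam i) - P₀) + (P₀ - ys)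
        - (S.lam i - mean S.lam)) (mean S.lam - ys)
      have q2 := norm_sub_le ((nonnegPart (ρ • G.conEstimate S i + S.lam i) - P₀) + (P₀ - ys))
        (S.lam i - mean S.lam)
      have q3 := norm_add_le (nonnegPart (ρ • G.conEstimate S i + S.lam i) - P₀) (P₀ - ys)
      have q4 : 0 ≤ ρ * ‖G.couplingMap‖ * D := by positivity
      have q5 : 0 ≤ ρ * a := by positivity
      linarith
    have h3 := disagreement_step_le hN hlip hnet hσ hδ.le (by positivity) hGlam (by positivity) hx
    have h4 : δ * (N * (K₂ * (a + D) + (|β₃| + N * ‖G.couplingMap‖) * (K * (1 + K₁) * (a + D))))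
        = δ * L₂ * (a + D) := by simp only [L₂]; ring
    rw [h4] at h3
    have h5 : δ * L₂ * (a + D) ≤ δ * (L₁ + L₂) * (a + D) := by gcongr; linarith
    linarith

end Game

end AggregativeGame

/-! ### Equilibrium and linear rate -/

theorem theorem3 {N d m : ℕ} (hN : 0 < N) {n : Fin N → ℕ}
    (G : AggregativeGame.Game N d m n)
    (E : Digraph (Fin N)) (w : Matrix (Fin N) (Fin N) ℝ)
    (μ β₁ β₂ β₃ κ₁ κ₂ ρ : ℝ)
    (hsmooth : G.SmoothCosts)
    (hμ : 0 < μ) (hmono : G.StronglyMonotone μ)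
    (hlip : G.LipschitzCosts β₁ β₂ β₃)
    (hnet : AggregativeGame.IsNetwork E w)
    (hfeas : G.feasibleSet.Nonempty)
    (hκ₁ : 0 < κ₁) (hκ₂ : 0 < κ₂)
    (hA₁ : (G.matA * G.matA.transpose - κ₁ • (1 : Matrix (Fin m) (Fin m) ℝ)).PosSemidef)
    (hA₂ : (κ₂ • (1 : Matrix (Fin m) (Fin m) ℝ) - G.matA * G.matA.transpose).PosSemidef)
    (hρ : 0 < ρ) :
    ∃ xs : AggregativeGame.Profile n,
      (G.IsVariationalGNE xs ∧ ∀ x, G.IsVariationalGNE x → x = xs) ∧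
      G.IsGNE xs ∧
      ∃ δbar : ℝ, 0 < δbar ∧ ∃ a₂ : ℝ, 0 < a₂ ∧
        ∀ S₀ : AggregativeGame.State N d m n, S₀.Admissible →
          ∃ a₁ : ℝ, 0 < a₁ ∧
            ∀ δ : ℝ, 0 < δ → δ < δbar → (∀ i, δ / ρ < w i i) →
              ∀ t : ℕ, ‖((G.step w ρ δ)^[t] S₀).x - xs‖ ≤ a₁ * Real.exp (-(a₂ * δ * t)) := by
  have hA := G.le_norm_couplingMapT_sq hA₁
  obtain ⟨xs, ys, h₁, h₂⟩ := AggregativeGame.exists_primalDual_equilibrium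
    G.inner_couplingMapT hκ₁ hA hμ hρ (by positivity) (∑ i, G.b i) G.F AggregativeGame.nonnegPart
    hmono (AggregativeGame.Game.norm_F_sub_le hN hlip) AggregativeGame.nonnegPart_firm
  rw [h₂] at h₁
  have hvi := AggregativeGame.Game.isVariationalGNE_of_kkt hρ h₁ h₂
  refine ⟨xs, ⟨hvi, fun x hx => hx.unique hμ hmono hvi⟩, hvi.isGNE hsmooth hμ.le hmono, ?_⟩
  obtain ⟨α, c, σ, L, hα, hc, hσ0, hσ1, hL, H⟩ :=
    AggregativeGame.Game.exists_step_estimates hN hsmooth hμ hmono hlip hnet hκ₁ hA hρ h₁ h₂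
  have hAn : 0 ≤ ‖G.couplingMap‖ := norm_nonneg _
  obtain ⟨δbar, hδbar, κ, hκ, Hr⟩ :=
    AggregativeGame.exists_two_timescale_rate (M := α + ‖G.couplingMap‖) hc hL hσ0 hσ1
      (by linarith)
  -- The rate is halved because `U` dominates the squared distance.
  refine ⟨δbar, hδbar, κ / 2, by positivity, fun S₀ hS₀ => ?_⟩
  let U : AggregativeGame.State N d m n → ℝ := fun S =>
    AggregativeGame.primalDualForm G.couplingMap α (S.x - xs) (AggregativeGame.mean S.lam - ys)
      + G.disagreement S ^ 2
  have hUlow : ∀ S, ‖S.x - xs‖ ^ 2 ≤ U S := by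
    intro S
    have := AggregativeGame.le_primalDualForm G.couplingMap hα (S.x - xs)
      (AggregativeGame.mean S.lam - ys)
    simp only [U]
    nlinarith [sq_nonneg ‖AggregativeGame.mean S.lam - ys‖, sq_nonneg (G.disagreement S)]
  have hU0 : ∀ S, 0 ≤ U S := fun S => (sq_nonneg _).trans (hUlow S)
  -- `U S₀` does not involve `δ`, so neither does the constant; the `1` only secures positivity.
  refine ⟨√(U S₀) + 1, by positivity, fun δ hδ hδlt _ t => ?_⟩
  -- The zero sums are carried along the induction because the one-step estimates hold only for
  -- exact tracker averages.
  have hinv : ∀ t : ℕ, ∑ i, ((G.step w ρ δ)^[t] S₀).z i = 0 ∧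
      ∑ i, ((G.step w ρ δ)^[t] S₀).y i = 0 ∧
      U ((G.step w ρ δ)^[t] S₀) ≤ Real.exp (-(κ * δ * t)) * U S₀ := by
    intro t
    induction t with
    | zero => exact ⟨hS₀.sum_z, hS₀.sum_y, by simp⟩
    | succ t ih =>
      obtain ⟨hz, hy, hU⟩ := ih
      rw [Function.iterate_succ_apply']
      set S := (G.step w ρ δ)^[t] S₀
      refine ⟨AggregativeGame.Game.sum_z_step hnet.doubly_stochastic hz,
        AggregativeGame.Game.sum_y_step hnet.doubly_stochastic hy, ?_⟩
      obtain ⟨hV, hD⟩ := H δ S hδ hz hy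
      have hstep : U (G.step w ρ δ S) ≤ (1 - κ * δ) * U S :=
        Hr δ hδ hδlt _ _ _ _ _ (add_nonneg (norm_nonneg _) (norm_nonneg _))
          AggregativeGame.Game.disagreement_nonneg AggregativeGame.Game.disagreement_nonneg
          (AggregativeGame.primalDualForm_le G.couplingMap (by linarith) _ _) hV hD
      calc U (G.step w ρ δ S) ≤ (1 - κ * δ) * U S := hstep
        _ ≤ Real.exp (-(κ * δ)) * U S := by
            gcongr
            · exact hU0 S
            · exact Real.one_sub_le_exp_neg _
        _ ≤ Real.exp (-(κ * δ)) * (Real.exp (-(κ * δ * t)) * U S₀) := by gcongr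
        _ = _ := by
            rw [← mul_assoc, ← Real.exp_add]
            congr 2
            push_cast
            ring
  have hsq : ‖((G.step w ρ δ)^[t] S₀).x - xs‖ ^ 2
      ≤ (√(U S₀) * Real.exp (-(κ / 2 * δ * t))) ^ 2 := by
    refine ((hUlow _).trans (hinv t).2.2).trans_eq ?_
    rw [mul_pow, Real.sq_sqrt (hU0 S₀), ← Real.exp_nat_mul, mul_comm]
    congr 2
    push_cast
    ring
  refine ((sq_le_sq₀ (norm_nonneg _) (by positivity)).mp hsq).trans ?_
  gcongr
  linarith
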